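/- **Setting.** For $\rho\in[0,1]$ let $\mathcal N_\rho(x)=x\oplus e$ with $e\leftarrow\mathrm{Ber}((1-\rho)/2)^n$. A zero-bit code consists of randomized algorithms $\mathsf{KeyGen}$, $\mathsf{Enc}(\mathsf{sk})\in\{0,1\}^n$ and $\mathsf{Dec}(\mathsf{sk},x)\in\{1,\bot\}$. It is a $(\delta,\varepsilon,\mu)$-PRC for $\mathcal N_\rho$ against $q$-query adversaries ($q\in\mathbb N\cup\{\infty\}$) if, for $\mathsf{sk}\leftarrow\mathsf{KeyGen}$: * (completeness) $\Pr[\mathsf{Dec}(\mathsf{sk},\mathcal N_\rho(\mathsf{Enc}(\mathsf{sk})))=1]\ge 1-\delta$; * (statistical pseudorandomness) every computationally unbounded randomized adversary that receives at most $q$ fresh encodings under the same key distinguishes them from independent uniform words with advantage at most $\varepsilon$; * (soundness) $\Pr[\mathsf{Dec}(\mathsf{sk},c^*)=\bot]\ge 1-\mu$ for every fixed $c^*\in\{0,1\}^n$. In the standard model keys are bit strings and there is no oracle. In the (secret) random oracle model with security parameter $\lambda$, $\mathsf{Enc}$ and $\mathsf{Dec}$ (but neither $\mathsf{KeyGen}$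 nor the adversary) also query one uniformly random function $\mathcal R:\{0,1\}^\lambda\to\{0,1\}$, drawn once and shared by all their runs, and all probabilities include the choice of $\mathcal R$. **Lemma.** There is an absolute constant $C>0$ such that the following holds. Let $n,\ell,Q:\mathbb N\to\mathbb N$, $q:\mathbb N\to\mathbb N\cup\{\infty\}$, $\rho:\mathbb N\to[0,1]$, $\tau:\mathbb N\to(0,1)$ and $\delta,\varepsilon,\mu:\mathbb N\to\mathbb R$ be functions of the security parameter $\lambda\ge1$ (the dependence on $\lambda$ is left implicit). Let $(\mathsf{KeyGen},\mathsf{Enc}^{\mathcal R},\mathsf{Dec}^{\mathcal R})$ be a zero-bit $(\delta,\varepsilon,\mu)$-PRC in the random oracle model, for $\mathcal N_\rho$ and against $q$-query adversaries, whose keys have length at most $\ell$ and where each run of $\mathsf{Enc}^{\mathcal R}$ and of $\mathsf{Dec}^{\mathcal R}$ makes at most $Q$ queries. Suppose that $q\ge1$ and that either $q=\infty$, or $m\,\varepsilon n\ge \ell+Q\lambda^2/\tau$ for some integer $m\le q$. Put $$\delta'=\delta+2^{-\lambda}\,\frac Q\tau+Q^2\,\tau^{\frac12\cdot\frac{1-\rho^2}{1+\rho^2}}+C\,Q^2\sqrt{\varepsilon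 n}.$$ Consider the following compiled scheme $(\mathsf{KeyGen}',\mathsf{Enc}'_0,\mathsf{Dec}')$ in the standard model. $\mathsf{KeyGen}'$ samples $\mathsf{sk}\leftarrow\mathsf{KeyGen}$ and a random $F_0:\{0,1\}^\lambda\to\{0,1\}$, runs $\mathsf{Dec}^{F_0}(\mathsf{sk},x)$ on $\lceil\lambda/\tau\rceil$ independent uniform words $x$, records all query-response pairs in a table $S$, and outputs a bit-string encoding of $\mathsf{sk}'=(\mathsf{sk},S)$. $\mathsf{Enc}'_0(\mathsf{sk}')$ samples a fresh uniformly random function $F_1$ consistent with $S$ and runs $\mathsf{Enc}^{F_1}(\mathsf{sk})$. $\mathsf{Dec}'(\mathsf{sk}',x)$ samples a fresh uniformly random function $F_2$ consistent with $S$ and runs $\mathsf{Dec}^{F_2}(\mathsf{sk},x)$. Then: 1. There is an encoder $\mathsf{Enc}'$ such that $(\mathsf{KeyGen}',\mathsf{Enc}',\mathsf{Dec}')$ is a $(\delta',\varepsilon,\mu)$-PRC in the standard model for $\mathcal N_\rho$ and against $q$-query adversaries, with keys of length at most $\ell+C\,Q\lambda^2/\tau$. 2. The scheme $(\mathsf{KeyGen}',\mathsf{Enc}'_0,\mathsf{Dec}')$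 itself is a $(\delta',\varepsilon,\mu)$-PRC for $\mathcal N_\rho$ against adversaries that receive one encoding. 3. The key stores the $\tau$-heavy decoder queries: except with probability at most $2^{-\lambda}Q/\tau$ over $\mathsf{KeyGen}'$, the table $S$ contains every query that $\mathsf{Dec}^{F_0}(\mathsf{sk},x)$ makes with probability at least $\tau$ over uniform $x\in\{0,1\}^n$ and the coins of $\mathsf{Dec}$. -/

import Mathlib

namespace PRC

/-- Bit strings of length `n`. -/
abbrev Word (n : ℕ) : Type := Fin n → Bool

/-- Oracles `{0,1}^lam → {0,1}`; a random oracle is a uniformly random element. -/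
abbrev Oracle (lam : ℕ) : Type := Word lam → Bool

/-- The probability of the outcome `a` under `p`, as a real number. -/
noncomputable def prob {α : Type} (p : PMF α) (a : α) : ℝ := (p a).toReal

/-- `m` independent samples from `p`. -/
noncomputable def iid {α : Type} (p : PMF α) : (m : ℕ) → PMF (Fin m → α)
  | 0 => PMF.pure Fin.elim0
  | m + 1 => p.bind fun a => (iid p m).map fun v => (Fin.cons a v : Fin (m + 1) → α)

/-- The bit that is `true` with probability `(1-ρ)/2`. -/
noncomputable def flipBit (ρ : unitInterval) : PMF Bool :=
  PMF.ofFintype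
    (fun b => if b then ENNReal.ofReal ((1 - (ρ : ℝ)) / 2) else ENNReal.ofReal ((1 + (ρ : ℝ)) / 2))
    (by
      have h0 := ρ.2.1
      have h1 := ρ.2.2
      rw [Fintype.sum_bool]
      simp only [if_true, Bool.false_eq_true, if_false]
      rw [← ENNReal.ofReal_add (by linarith) (by linarith), ← ENNReal.ofReal_one]
      congr 1
      ring)

/-- The binary symmetric channel `N_ρ(x) = x ⊕ e` with `e ← Ber((1-ρ)/2)^n`. -/
noncomputable def noise (ρ : unitInterval) {n : ℕ} (x : Word n) : PMF (Word n) :=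
  (iid (flipBit ρ) n).map fun e i => xor (x i) (e i)

/-! ### Zero-bit codes -/

/-- A zero-bit secret-key coding scheme with (shared secret) keys in `K` and codewords in
`{0,1}^n`.  The decoder's output `true` is the message `1`, its output `false` is `⊥`. -/
structure Code (K : Type) (n : ℕ) where
  keyGen : PMF K
  enc : K → PMF (Word n)
  dec : K → Word n → PMF Bool

namespace Code

variable {K : Type} {n : ℕ}

/-- `δ`-completeness for the channel `N_ρ`. -/
def Complete (P : Code K n) (ρ : unitInterval) (δ : ℝ) : Prop :=
  1 - δ ≤ prob (P.keyGen.bind fun k => (P.enc k).bind fun c => (noise ρ c).bind fun c' =>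
    P.dec k c') true

/-- Statistical `ε`-pseudorandomness against all (computationally unbounded, randomized)
adversaries that request at most `q` fresh encodings under one key; `q = ⊤` means that the number
of requests is not bounded.  The encoding oracle of a zero-bit code has no input, so an adversary
is a randomized test of the codewords that it receives. -/
def Pseudorandom (P : Code K n) (q : ℕ∞) (ε : ℝ) : Prop :=
  ∀ m : ℕ, (m : ℕ∞) ≤ q → ∀ A : (Fin m → Word n) → PMF Bool,
    |prob (P.keyGen.bind fun k => (iid (P.enc k) m).bind A) true -
      prob ((iid (PMF.uniformOfFintype (Word n)) m).bind A) true| ≤ ε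

/-- `μ`-soundness: every fixed word is rejected except with probability `μ`. -/
def Sound (P : Code K n) (μ : ℝ) : Prop :=
  ∀ c : Word n, 1 - μ ≤ prob (P.keyGen.bind fun k => P.dec k c) false

/-- A zero-bit `(δ, ε, μ)`-pseudorandom code for the channel `N_ρ`, where pseudorandomness holds
against all adversaries that make at most `q` queries. -/
structure IsPRC (P : Code K n) (ρ : unitInterval) (q : ℕ∞) (δ ε μ : ℝ) : Prop where
  complete : P.Complete ρ δ
  pseudorandom : P.Pseudorandom q ε
  sound : P.Sound μ

end Code

/-! ### Algorithms with oracle access -/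

/-- Deterministic oracle algorithms with output in `α`, as adaptive decision trees.  A randomized
oracle algorithm is a distribution over them (it draws its coins first). -/
inductive QueryTree (lam : ℕ) (α : Type) : Type
  | output (a : α) : QueryTree lam α
  | query (x : Word lam) (next : Bool → QueryTree lam α) : QueryTree lam α

namespace QueryTree

variable {lam : ℕ} {α : Type}

/-- The output of the algorithm when its oracle is `F`. -/
def eval (F : Oracle lam) : QueryTree lam α → α
  | output a => a
  | query x next => (next (F x)).eval F

/-- The query-response pairs of the run with oracle `F`, in order. -/
def transcript (F : Oracle lam) : QueryTree lam α → List (Word lam × Bool)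
  | output _ => []
  | query x next => (x, F x) :: (next (F x)).transcript F

/-- At most `Q` queries are made, whatever the oracle is. -/
def QueriesAtMost (T : QueryTree lam α) (Q : ℕ) : Prop :=
  ∀ F : Oracle lam, (T.transcript F).length ≤ Q

end QueryTree

/-- A zero-bit coding scheme in the random oracle model, at security parameter `lam`.  Keys are
bit strings, the encoder and the decoder have access to an oracle, key generation does not. -/
structure ROCode (lam n : ℕ) where
  keyGen : PMF (List Bool)
  enc : List Bool → PMF (QueryTree lam (Word n))
  dec : List Bool → Word n → PMF (QueryTree lam Bool)

/-- A zero-bit coding scheme in the standard model: keys are bit strings. -/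
abbrev StdCode (n : ℕ) : Type := Code (List Bool) n

namespace ROCode

variable {lam n : ℕ}

/-- The scheme run with a secret random oracle: a uniformly random oracle is drawn once and shared
by all runs of the encoder and of the decoder; adversaries have no access to it. -/
noncomputable def inROM (P : ROCode lam n) : Code (List Bool × Oracle lam) n where
  keyGen := P.keyGen.bind fun sk => (PMF.uniformOfFintype (Oracle lam)).map fun R => (sk, R)
  enc k := (P.enc k.1).map fun T => T.eval k.2
  dec k c := (P.dec k.1 c).map fun T => T.eval k.2

/-- Each run of the encoder and of the decoder makes at most `Q` oracle queries. -/
def QueriesAtMost (P : ROCode lam n) (Q : ℕ) : Prop :=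
  ∀ sk ∈ P.keyGen.support,
    (∀ T ∈ (P.enc sk).support, T.QueriesAtMost Q) ∧
      ∀ c, ∀ T ∈ (P.dec sk c).support, T.QueriesAtMost Q

end ROCode

/-! ### The compiler -/

/-- One slot of a table of query-response pairs, on `lam + 2` bits; the first bit says whether the
slot is used. -/
def encodeSlot {lam : ℕ} : Option (Word lam × Bool) → List Bool
  | none => List.replicate (lam + 2) false
  | some (x, b) => true :: b :: List.ofFn x

def decodeSlot (lam : ℕ) (l : List Bool) : Option (Word lam × Bool) :=
  if l.getD 0 false then some (fun i => l.getD (i + 2) false, l.getD 1 false) else none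

/-- The key `(sk, S)` as a bit string: `N` slots for the table `S`, followed by `sk`. -/
def encodeKey {lam : ℕ} (N : ℕ) (sk : List Bool) (S : List (Word lam × Bool)) : List Bool :=
  (List.range N).flatMap (fun i => encodeSlot S[i]?) ++ sk

/-- Recovers `(sk, S)`. -/
def parseKey (lam N : ℕ) (k : List Bool) : List Bool × List (Word lam × Bool) :=
  (k.drop (N * (lam + 2)),
    (List.range N).filterMap fun i => decodeSlot lam ((k.drop (i * (lam + 2))).take (lam + 2)))

/-- A uniformly random oracle among those consistent with the table `S`: the answers in `S`, and
independent uniform bits elsewhere. -/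
noncomputable def consistentOracle {lam : ℕ} (S : List (Word lam × Bool)) : PMF (Oracle lam) :=
  (PMF.uniformOfFintype (Oracle lam)).map fun G x => (S.lookup x).getD (G x)

/-- The query-response pairs of one run of the decoder with key `sk` and oracle `F` on a uniformly
random word. -/
noncomputable def decoderRun {lam n : ℕ} (P : ROCode lam n) (sk : List Bool) (F : Oracle lam) :
    PMF (List (Word lam × Bool)) :=
  (PMF.uniformOfFintype (Word n)).bind fun x => (P.dec sk x).map fun T => T.transcript F

/-- The table of the query-response pairs of `N` independent such runs. -/
noncomputable def decoderTable {lam n : ℕ} (P : ROCode lam n) (N : ℕ) (sk : List Bool)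
    (F : Oracle lam) : PMF (List (Word lam × Bool)) :=
  (iid (decoderRun P sk F) N).map fun v => (List.ofFn v).flatten

/-- The query `x` is `τ`-heavy for `sk` and `F`: the decoder asks it with probability at least `τ`
on a uniformly random word. -/
def Heavy {lam n : ℕ} (P : ROCode lam n) (τ : ℝ) (sk : List Bool) (F : Oracle lam)
    (x : Word lam) : Prop :=
  τ ≤ prob ((decoderRun P sk F).map fun t => ∃ b, (x, b) ∈ t) True

/-- The compiled scheme with threshold `τ`, for a scheme with at most `Q` queries.  The new key
stores the query-response pairs of `⌈lam / τ⌉` runs of the decoder on random words; the encoder and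
the decoder run the original algorithms, each with its own fresh oracle consistent with them. -/
noncomputable def compile {lam n : ℕ} (P : ROCode lam n) (Q : ℕ) (τ : ℝ) : StdCode n where
  keyGen := P.keyGen.bind fun sk => (PMF.uniformOfFintype (Oracle lam)).bind fun F₀ =>
    (decoderTable P ⌈lam / τ⌉₊ sk F₀).map fun S => encodeKey (Q * ⌈lam / τ⌉₊) sk S
  enc k :=
    let s := parseKey lam (Q * ⌈lam / τ⌉₊) k
    (consistentOracle s.2).bind fun F₁ => (P.enc s.1).map fun T => T.eval F₁
  dec k c :=
    let s := parseKey lam (Q * ⌈lam / τ⌉₊) k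
    (consistentOracle s.2).bind fun F₂ => (P.dec s.1 c).map fun T => T.eval F₂

/-- The probability that, in the key generation of the compiled scheme, the stored table misses some
`τ`-heavy query of the decoder. -/
noncomputable def missProbability {lam n : ℕ} (P : ROCode lam n) (τ : ℝ) : ℝ :=
  prob (P.keyGen.bind fun sk => (PMF.uniformOfFintype (Oracle lam)).bind fun F₀ =>
    (decoderTable P ⌈lam / τ⌉₊ sk F₀).map fun S =>
      ∃ x, Heavy P τ sk F₀ x ∧ ∀ b, (x, b) ∉ S) True

/-- The completeness error of the compiled scheme, where `C` is the constant in `O(Q²√(εn))`. -/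
noncomputable def compiledError (C ρ : ℝ) (lam n Q : ℕ) (τ δ ε : ℝ) : ℝ :=
  δ + (2⁻¹ : ℝ) ^ lam * Q / τ + (Q : ℝ) ^ 2 * τ ^ ((1 / 2 : ℝ) * ((1 - ρ ^ 2) / (1 + ρ ^ 2)))
    + C * ((Q : ℝ) ^ 2 * √(ε * n))

end PRC

/-!
The key stores a sample of decoder queries on uniform words, so that queries of probability at least
`τ` are missed only with probability `2^{-λ} Q / τ`.  By lazy sampling, running the encoder and the
decoder with independent oracles consistent with the table, instead of a shared one, is noticed only
if both ask the same query outside the table.  For a fixed encoder query `y`, let `g x` be the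
probability that the decoder asks `y` outside the table on the word `x`.  If the table misses no
heavy query, `g` has mean at most `τ`, and hypercontractivity of the noise operator bounds the mean
of `T_ρ g` over an event of the encoder's randomness by a power of `τ`, provided that the codeword
is uniform.

The codeword is nearly uniform even given the key: `m` pseudorandom codewords have nearly full
entropy `m n`, and conditioning on a key costs at most its length, which is small compared to
`m ε n`.  Hence the entropy deficit per codeword is of order `ε n`, and Pinsker's inequality turns
it into total variation distance of order `√(ε n)`.
-/

namespace PRC

open scoped BigOperators ENNReal

/-! ### Expectations -/

/-- The expectation of a function with values in `[0, ∞]` under a probability mass function. -/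
noncomputable def mean {α : Type*} (p : PMF α) (f : α → ℝ≥0∞) : ℝ≥0∞ := ∑' a, p a * f a

section Mean

variable {α β : Type*} (p : PMF α)

theorem mean_pure (a : α) (f : α → ℝ≥0∞) : mean (PMF.pure a) f = f a := by
  rw [mean, tsum_eq_single a fun b hb => by simp [hb]]
  simp

theorem mean_bind (k : α → PMF β) (f : β → ℝ≥0∞) :
    mean (p.bind k) f = mean p fun a => mean (k a) f := by
  simp only [mean, PMF.bind_apply, ← ENNReal.tsum_mul_right, ← ENNReal.tsum_mul_left, mul_assoc]
  exact ENNReal.tsum_comm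

theorem mean_map (g : α → β) (f : β → ℝ≥0∞) : mean (p.map g) f = mean p fun a => f (g a) := by
  rw [← PMF.bind_pure_comp, mean_bind]
  simp only [Function.comp_apply, mean_pure]

theorem mean_const (c : ℝ≥0∞) : mean p (fun _ => c) = c := by
  simp [mean, ENNReal.tsum_mul_right]

theorem mean_add (f g : α → ℝ≥0∞) : mean p (fun a => f a + g a) = mean p f + mean p g := by
  simp only [mean, mul_add, ENNReal.tsum_add]

theorem mean_const_mul (c : ℝ≥0∞) (f : α → ℝ≥0∞) :
    mean p (fun a => c * f a) = c * mean p f := by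
  simp only [mean, ← ENNReal.tsum_mul_left, mul_left_comm c]

theorem mean_mul_const (c : ℝ≥0∞) (f : α → ℝ≥0∞) :
    mean p (fun a => f a * c) = mean p f * c := by
  simp only [mul_comm _ c, mean_const_mul]

theorem mean_sum {ι : Type*} (s : Finset ι) (f : ι → α → ℝ≥0∞) :
    mean p (fun a => ∑ i ∈ s, f i a) = ∑ i ∈ s, mean p (f i) := by
  simp only [mean, Finset.mul_sum]
  exact Summable.tsum_finsetSum fun _ _ => ENNReal.summable

theorem mean_comm (q : PMF β) (f : α → β → ℝ≥0∞) :
    (mean p fun a => mean q fun b => f a b) = mean q fun b => mean p fun a => f a b := by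
  simp only [mean, ← ENNReal.tsum_mul_left, mul_left_comm]
  exact ENNReal.tsum_comm

theorem mean_eq_sum [Fintype α] (f : α → ℝ≥0∞) : mean p f = ∑ a, p a * f a := tsum_fintype _

theorem mean_eq_sum_of_support_subset {s : Finset α} (hs : p.support ⊆ s) (f : α → ℝ≥0∞) :
    mean p f = ∑ a ∈ s, p a * f a := by
  refine tsum_eq_sum fun a ha => ?_
  rw [(p.apply_eq_zero_iff a).2 fun h => ha (hs h), zero_mul]

theorem mean_uniformOfFintype [Fintype α] [Nonempty α] (f : α → ℝ≥0∞) :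
    mean (PMF.uniformOfFintype α) f = (Fintype.card α : ℝ≥0∞)⁻¹ * ∑ a, f a := by
  simp only [mean_eq_sum, PMF.uniformOfFintype_apply, Finset.mul_sum]

theorem sum_toReal_apply_of_support_subset {s : Finset α} (hs : p.support ⊆ s) :
    ∑ a ∈ s, (p a).toReal = 1 := by
  have h : ∑ a ∈ s, p a * 1 = 1 := by rw [← mean_eq_sum_of_support_subset p hs, mean_const]
  simp only [mul_one] at h
  rw [← ENNReal.toReal_sum fun a _ => p.apply_ne_top a, h, ENNReal.toReal_one]

theorem sum_toReal_apply [Fintype α] : ∑ a, (p a).toReal = 1 :=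
  sum_toReal_apply_of_support_subset p (by simp)

theorem toReal_bind_apply {s : Finset α} (hs : p.support ⊆ s) (k : α → PMF β) (b : β) :
    (p.bind k b).toReal = ∑ a ∈ s, (p a).toReal * (k a b).toReal := by
  have h : p.bind k b = ∑ a ∈ s, p a * k a b := mean_eq_sum_of_support_subset p hs fun a => k a b
  rw [h, ENNReal.toReal_sum fun a _ => ENNReal.mul_ne_top (p.apply_ne_top a) ((k a).apply_ne_top b)]
  simp only [ENNReal.toReal_mul]

theorem sum_toReal_map_mul [Fintype α] [Fintype β] (g : α → β) (f : β → ℝ) :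
    ∑ b, (p.map g b).toReal * f b = ∑ a, (p a).toReal * f (g a) := by
  classical
  have h : ∀ b, (p.map g b).toReal = ∑ a, if b = g a then (p a).toReal else 0 := fun b => by
    rw [← PMF.bind_pure_comp, toReal_bind_apply p (s := Finset.univ) (by simp)]
    simp [apply_ite ENNReal.toReal]
  simp only [h, Finset.sum_mul, ite_mul, zero_mul]
  rw [Finset.sum_comm]
  simp

theorem mean_ofReal [Fintype α] {f : α → ℝ} (hf : ∀ a, 0 ≤ f a) :
    mean p (fun a => ENNReal.ofReal (f a)) = ENNReal.ofReal (∑ a, (p a).toReal * f a) := by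
  rw [mean_eq_sum, ENNReal.ofReal_sum_of_nonneg
    fun a _ => mul_nonneg ENNReal.toReal_nonneg (hf a)]
  refine Finset.sum_congr rfl fun a _ => ?_
  rw [ENNReal.ofReal_mul ENNReal.toReal_nonneg, ENNReal.ofReal_toReal (p.apply_ne_top a)]

theorem apply_eq_mean [DecidableEq α] (a : α) : p a = mean p fun x => if x = a then 1 else 0 := by
  simp [mean]

theorem apply_true_eq_mean (p : PMF Bool) : p true = mean p fun b => if b then 1 else 0 := by
  simp [mean_eq_sum]

open scoped Classical in
theorem map_apply_true_eq_mean (g : α → Prop) :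
    (p.map g) True = mean p fun a => if g a then 1 else 0 := by
  rw [apply_eq_mean, mean_map]
  simp only [eq_iff_iff, iff_true]

variable {p}

theorem mean_mono {f g : α → ℝ≥0∞} (h : ∀ a ∈ p.support, f a ≤ g a) : mean p f ≤ mean p g := by
  refine ENNReal.tsum_le_tsum fun a => ?_
  by_cases ha : a ∈ p.support
  · gcongr
    exact h a ha
  · rw [(p.apply_eq_zero_iff a).2 ha, zero_mul, zero_mul]

theorem mean_congr {f g : α → ℝ≥0∞} (h : ∀ a ∈ p.support, f a = g a) : mean p f = mean p g :=
  (mean_mono fun a ha => (h a ha).le).antisymm (mean_mono fun a ha => (h a ha).ge)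

theorem mean_le_of_forall_le {f : α → ℝ≥0∞} {c : ℝ≥0∞} (h : ∀ a ∈ p.support, f a ≤ c) :
    mean p f ≤ c :=
  (mean_mono h).trans (mean_const p c).le

theorem eq_of_forall_mean_eq {q : PMF α} (h : ∀ f, mean p f = mean q f) : p = q := by
  classical
  ext a
  rw [apply_eq_mean, apply_eq_mean, h]

end Mean

section Iid

variable {α β : Type} (p : PMF α)

theorem mean_iid_zero (f : (Fin 0 → α) → ℝ≥0∞) : mean (iid p 0) f = f Fin.elim0 :=
  mean_pure _ _

theorem mean_iid_succ (m : ℕ) (f : (Fin (m + 1) → α) → ℝ≥0∞) :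
    mean (iid p (m + 1)) f = mean p fun a => mean (iid p m) fun v => f (Fin.cons a v) := by
  simp only [iid, mean_bind, mean_map]

theorem mean_iid_one (f : (Fin 1 → α) → ℝ≥0∞) :
    mean (iid p 1) f = mean p fun a => f fun _ => a := by
  simp only [mean_iid_succ, mean_iid_zero]
  congr! 3 with a
  exact funext fun i => by rw [Fin.fin_one_eq_zero i, Fin.cons_zero]

theorem mean_iid_prod (m : ℕ) (f : α → ℝ≥0∞) :
    (mean (iid p m) fun v => ∏ i, f (v i)) = mean p f ^ m := by
  induction m with
  | zero => simp [mean_iid_zero]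
  | succ m ih =>
    simp only [mean_iid_succ, Fin.prod_univ_succ, Fin.cons_zero, Fin.cons_succ, mean_const_mul,
      mean_mul_const, ih, pow_succ']

theorem iid_apply (m : ℕ) (v : Fin m → α) : iid p m v = ∏ i, p (v i) := by
  classical
  induction m with
  | zero => simp [iid, Subsingleton.elim v Fin.elim0]
  | succ m ih =>
    have hcons : ∀ a w, (Fin.cons a w : Fin (m + 1) → α) = v ↔ a = v 0 ∧ w = Fin.tail v :=
      fun a w =>
        ⟨by rintro rfl; simp, by rintro ⟨rfl, rfl⟩; exact Fin.cons_self_tail v⟩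
    have hite : ∀ a w, (if (Fin.cons a w : Fin (m + 1) → α) = v then (1 : ℝ≥0∞) else 0) =
        (if a = v 0 then 1 else 0) * (if w = Fin.tail v then 1 else 0) := fun a w => by
      rw [ite_zero_mul_ite_zero, one_mul, if_congr (hcons a w) rfl rfl]
    rw [apply_eq_mean, mean_iid_succ]
    simp only [hite, mean_const_mul, mean_mul_const]
    rw [← apply_eq_mean, ← apply_eq_mean, ih, Fin.prod_univ_succ]
    rfl

theorem mem_support_of_mem_support_iid {m : ℕ} {v : Fin m → α} (hv : v ∈ (iid p m).support)
    (i : Fin m) : v i ∈ p.support := by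
  rw [PMF.mem_support_iff, iid_apply] at hv
  exact Finset.prod_ne_zero_iff.1 hv i (Finset.mem_univ i)

theorem iid_map (g : α → β) (m : ℕ) : iid (p.map g) m = (iid p m).map fun v i => g (v i) := by
  refine eq_of_forall_mean_eq fun f => ?_
  induction m with
  | zero =>
    simp only [mean_iid_zero, mean_map]
    exact congrArg f (Subsingleton.elim _ _)
  | succ m ih =>
    simp only [mean_iid_succ, mean_map, ih]
    congr! 5 with a v
    exact funext fun i => by cases i using Fin.cases <;> rfl

theorem iid_map_apply (m : ℕ) (i : Fin m) : (iid p m).map (fun v => v i) = p := by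
  refine eq_of_forall_mean_eq fun f => ?_
  rw [mean_map]
  induction m with
  | zero => exact i.elim0
  | succ m ih =>
    rw [mean_iid_succ]
    cases i using Fin.cases with
    | zero => simp only [Fin.cons_zero, mean_const]
    | succ j => simp only [Fin.cons_succ, ih, mean_const]

theorem iid_uniformOfFintype (α : Type) [Fintype α] [Nonempty α] (m : ℕ) :
    iid (PMF.uniformOfFintype α) m = PMF.uniformOfFintype (Fin m → α) := by
  ext v
  simp [iid_apply, ENNReal.inv_pow]

end Iid

/-! ### Relative entropy to the uniform distribution -/

/-- Gibbs' inequality. -/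
theorem sum_mul_log_le_sum_mul_log {α : Type*} {s : Finset α} {p r : α → ℝ} {M : ℝ} (hM : 0 < M)
    (hp : ∀ a ∈ s, 0 ≤ p a) (hr : ∀ a ∈ s, 0 ≤ r a) (hpr : ∀ a ∈ s, r a = 0 → p a = 0)
    (hsum : ∑ a ∈ s, r a ≤ ∑ a ∈ s, p a) :
    ∑ a ∈ s, p a * Real.log (M * r a) ≤ ∑ a ∈ s, p a * Real.log (M * p a) := by
  have hterm : ∀ a ∈ s, p a * Real.log (M * r a) - p a * Real.log (M * p a) ≤ r a - p a := by
    intro a ha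
    rcases (hp a ha).eq_or_lt with h | h
    · simpa [← h] using hr a ha
    · have hra : 0 < r a := (hr a ha).lt_of_ne fun h0 => h.ne' (hpr a ha h0.symm)
      have hlog := Real.log_le_sub_one_of_pos (div_pos hra h)
      rw [← mul_sub, ← Real.log_div (by positivity) (by positivity), mul_div_mul_left _ _ hM.ne']
      calc p a * Real.log (r a / p a) ≤ p a * (r a / p a - 1) := by gcongr
        _ = r a - p a := by field_simp
  have := Finset.sum_le_sum hterm
  simp only [Finset.sum_sub_distrib] at this
  linarith

theorem toReal_apply_le_one {α : Type*} (p : PMF α) (a : α) : (p a).toReal ≤ 1 :=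
  ENNReal.toReal_le_of_le_ofReal zero_le_one (by simpa using p.coe_le_one a)

/-- The total variation distance of a distribution from the uniform one. -/
noncomputable def tvUniform {α : Type*} [Fintype α] (p : PMF α) : ℝ :=
  ∑ a, max ((p a).toReal - (Fintype.card α : ℝ)⁻¹) 0

/-- The relative entropy (in nats) of a distribution with respect to the uniform one. -/
noncomputable def klUniform {α : Type*} [Fintype α] (p : PMF α) : ℝ :=
  ∑ a, (p a).toReal * Real.log (Fintype.card α * (p a).toReal)

section Entropy

variable {α κ ι : Type*} [Fintype α] [Fintype ι]

theorem tvUniform_nonneg (p : PMF α) : 0 ≤ tvUniform p :=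
  Finset.sum_nonneg fun _ _ => le_max_right _ _

theorem card_pos_of_pmf (p : PMF α) : (0 : ℝ) < Fintype.card α :=
  Nat.cast_pos.2 (Fintype.card_pos_iff.2 p.support_nonempty.to_type)

theorem klUniform_le_tvUniform_mul (p : PMF α) :
    klUniform p ≤ tvUniform p * (Real.log (Fintype.card α) + 1) := by
  have hM := card_pos_of_pmf p
  set M : ℝ := (Fintype.card α : ℝ)
  rw [tvUniform, Finset.sum_mul]
  refine Finset.sum_le_sum fun a _ => ?_
  have hpa : 0 ≤ (p a).toReal := ENNReal.toReal_nonneg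
  have hpa1 := toReal_apply_le_one p a
  set x := (p a).toReal
  rcases le_total x M⁻¹ with h | h
  · rw [max_eq_right (sub_nonpos.2 h), zero_mul]
    exact mul_nonpos_of_nonneg_of_nonpos hpa
      (Real.log_nonpos (by positivity) ((le_inv_mul_iff₀ hM).1 (by simpa using h)))
  · rw [max_eq_left (sub_nonneg.2 h)]
    have hx : 0 < x := (inv_pos.2 hM).trans_le h
    have hlogM : Real.log (M * x) ≤ Real.log M :=
      Real.log_le_log (by positivity) (mul_le_of_le_one_right hM.le hpa1)
    have hlog : M⁻¹ * Real.log (M * x) ≤ x - M⁻¹ := by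
      calc M⁻¹ * Real.log (M * x) ≤ M⁻¹ * (M * x - 1) := by
            gcongr
            exact Real.log_le_sub_one_of_pos (by positivity)
        _ = x - M⁻¹ := by field_simp
    calc x * Real.log (M * x) = (x - M⁻¹) * Real.log (M * x) + M⁻¹ * Real.log (M * x) := by ring
      _ ≤ (x - M⁻¹) * Real.log M + (x - M⁻¹) := by
        gcongr
      _ = (x - M⁻¹) * (Real.log M + 1) := by ring

theorem sq_sqrt_sub_one_le_klFun {t : ℝ} (ht : 0 ≤ t) :
    (√t - 1) ^ 2 ≤ InformationTheory.klFun t := by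
  rw [sub_sq, Real.sq_sqrt ht, InformationTheory.klFun]
  rcases ht.eq_or_lt with rfl | ht
  · simp
  · have hlog := Real.log_le_sub_one_of_pos (inv_pos.2 (Real.sqrt_pos.2 ht))
    rw [Real.log_inv, Real.log_sqrt ht.le] at hlog
    have hsqrt : t * (√t)⁻¹ = √t := by rw [← div_eq_mul_inv, Real.div_sqrt]
    nlinarith [mul_le_mul_of_nonneg_left hlog ht.le]

theorem card_mul_tvUniform (p : PMF α) :
    Fintype.card α * tvUniform p = (∑ a, |Fintype.card α * (p a).toReal - 1|) / 2 := by
  have hM := card_pos_of_pmf p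
  have hterm : ∀ a, Fintype.card α * max ((p a).toReal - (Fintype.card α : ℝ)⁻¹) 0 =
      (|Fintype.card α * (p a).toReal - 1| + (Fintype.card α * (p a).toReal - 1)) / 2 := fun a => by
    rw [mul_max_of_nonneg _ _ hM.le, mul_sub, mul_inv_cancel₀ hM.ne', mul_zero]
    simpa [div_eq_inv_mul, abs_sub_comm, add_comm, max_comm] using
      sup_eq_half_smul_add_add_abs_sub' ℝ 0 (Fintype.card α * (p a).toReal - 1)
  rw [tvUniform, Finset.mul_sum, Finset.sum_congr rfl fun a _ => hterm a, ← Finset.sum_div,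
    Finset.sum_add_distrib, Finset.sum_sub_distrib, ← Finset.mul_sum, sum_toReal_apply]
  simp

/-- Cauchy–Schwarz applied to `t - 1 = (√t - 1) (√t + 1)`, where the second factors have bounded
second moment. -/
theorem sq_tvUniform_le_hellinger (p : PMF α) :
    tvUniform p ^ 2 ≤
      (Fintype.card α : ℝ)⁻¹ * ∑ a, (√(Fintype.card α * (p a).toReal) - 1) ^ 2 := by
  have hM := card_pos_of_pmf p
  have htv := card_mul_tvUniform p
  have hcard : ∑ _a : α, (2 * 1 : ℝ) = 2 * Fintype.card α := by simp [mul_comm]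
  set M : ℝ := (Fintype.card α : ℝ)
  set t : α → ℝ := fun a => M * (p a).toReal
  have ht : ∀ a, 0 ≤ t a := fun a => by positivity
  have hfactor : ∀ a, |t a - 1| = |√(t a) - 1| * |√(t a) + 1| := fun a => by
    rw [← abs_mul, mul_comm, ← sq_sub_sq, one_pow, Real.sq_sqrt (ht a)]
  have hplus : ∑ a, (√(t a) + 1) ^ 2 ≤ 4 * M := by
    calc ∑ a, (√(t a) + 1) ^ 2 ≤ ∑ a, (2 * t a + 2 * 1) := by
          gcongr with a
          nlinarith [sq_nonneg (√(t a) - 1), Real.sq_sqrt (ht a)]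
      _ = 4 * M := by
          rw [Finset.sum_add_distrib, ← Finset.mul_sum, ← Finset.mul_sum, sum_toReal_apply, hcard]
          ring
  have hcs := Finset.sum_mul_sq_le_sq_mul_sq Finset.univ (fun a => |√(t a) - 1|)
    fun a => |√(t a) + 1|
  simp only [sq_abs, ← hfactor] at hcs
  rw [le_inv_mul_iff₀ hM]
  refine le_of_mul_le_mul_left ?_ hM
  calc M * (M * tvUniform p ^ 2) = (∑ a, |t a - 1|) ^ 2 / 4 := by
        rw [← mul_assoc, ← sq, ← mul_pow, htv]
        ring
    _ ≤ (∑ a, (√(t a) - 1) ^ 2) * (4 * M) / 4 := by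
        gcongr
        exact hcs.trans (by gcongr)
    _ = M * ∑ a, (√(t a) - 1) ^ 2 := by ring

/-- Pinsker's inequality, up to the constant. -/
theorem sq_tvUniform_le_klUniform (p : PMF α) : tvUniform p ^ 2 ≤ klUniform p := by
  have hM := card_pos_of_pmf p
  refine (sq_tvUniform_le_hellinger p).trans ?_
  calc (Fintype.card α : ℝ)⁻¹ * ∑ a, (√(Fintype.card α * (p a).toReal) - 1) ^ 2
      ≤ (Fintype.card α : ℝ)⁻¹ *
          ∑ a, InformationTheory.klFun (Fintype.card α * (p a).toReal) := by
        gcongr with a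
        exact sq_sqrt_sub_one_le_klFun (by positivity)
    _ = klUniform p := by
        simp only [InformationTheory.klFun, Finset.sum_add_distrib, Finset.sum_sub_distrib,
          mul_assoc, ← Finset.mul_sum, sum_toReal_apply]
        simp [hM.ne', klUniform]

theorem sum_klUniform_map_le [DecidableEq ι] (W : PMF (ι → α)) :
    ∑ i, klUniform (W.map fun c => c i) ≤ klUniform W := by
  set D : ι → PMF α := fun i => W.map fun c => c i
  have hpos : ∀ c, (W c).toReal ≠ 0 → ∀ i, (D i (c i)).toReal ≠ 0 := fun c hc i =>
    ENNReal.toReal_ne_zero.2 ⟨(PMF.mem_support_map_iff _ _ _).2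
      ⟨c, (ENNReal.toReal_ne_zero.1 hc).1, rfl⟩, PMF.apply_ne_top _ _⟩
  calc ∑ i, klUniform (D i)
      = ∑ c, (W c).toReal * ∑ i, Real.log (Fintype.card α * (D i (c i)).toReal) := by
        simp only [klUniform, Finset.mul_sum]
        rw [Finset.sum_comm (s := Finset.univ (α := ι → α))]
        refine Finset.sum_congr rfl fun i _ => ?_
        exact sum_toReal_map_mul W (fun c => c i) fun a =>
          Real.log (Fintype.card α * (D i a).toReal)
    _ = ∑ c, (W c).toReal * Real.log (Fintype.card (ι → α) * ∏ i, (D i (c i)).toReal) := by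
        refine Finset.sum_congr rfl fun c _ => ?_
        rcases eq_or_ne (W c).toReal 0 with hc | hc
        · rw [hc, zero_mul, zero_mul]
        · rw [← Real.log_prod fun i _ => mul_ne_zero (card_pos_of_pmf (D i)).ne' (hpos c hc i),
            Finset.prod_mul_distrib]
          simp
    _ ≤ klUniform W := by
        refine sum_mul_log_le_sum_mul_log (card_pos_of_pmf W) (fun c _ => ENNReal.toReal_nonneg)
          (fun c _ => Finset.prod_nonneg fun i _ => ENNReal.toReal_nonneg) (fun c _ h => ?_) ?_
        · obtain ⟨i, -, hi⟩ := Finset.prod_eq_zero_iff.1 h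
          by_contra hc
          exact hpos c hc i hi
        · have hprod := Finset.prod_univ_sum (fun _ : ι => (Finset.univ : Finset α))
            fun i a => (D i a).toReal
          rw [Fintype.piFinset_univ] at hprod
          simp [sum_toReal_apply, ← hprod]

theorem neg_sum_mul_log_le (w : PMF κ) {s : Finset κ} (hs : w.support ⊆ s) :
    -∑ k ∈ s, (w k).toReal * Real.log (w k).toReal ≤ Real.log s.card := by
  obtain ⟨k₀, hk₀⟩ := w.support_nonempty
  have hscard : (0 : ℝ) < s.card := Nat.cast_pos.2 (Finset.card_pos.2 ⟨k₀, hs hk₀⟩)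
  have hw := sum_toReal_apply_of_support_subset w hs
  have hgibbs := sum_mul_log_le_sum_mul_log (s := s) (p := fun k => (w k).toReal)
    (r := fun _ => (s.card : ℝ)⁻¹) hscard (by simp) (by simp) (by simp [hscard.ne'])
    (by simp [hw, hscard.ne'])
  have hlog : ∀ k ∈ s, (w k).toReal * Real.log (s.card * (w k).toReal) =
      (w k).toReal * Real.log s.card + (w k).toReal * Real.log (w k).toReal := fun k _ => by
    rcases eq_or_ne (w k).toReal 0 with h | h
    · simp [h]
    · rw [Real.log_mul hscard.ne' h, mul_add]
  rw [Finset.sum_congr rfl hlog, Finset.sum_add_distrib, mul_inv_cancel₀ hscard.ne',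
    Real.log_one, ← Finset.sum_mul, ← Finset.sum_mul, hw] at hgibbs
  linarith

theorem sum_mul_klUniform_le (w : PMF κ) {s : Finset κ} (hs : w.support ⊆ s) (W : κ → PMF α) :
    ∑ k ∈ s, (w k).toReal * klUniform (W k) ≤ Real.log s.card + klUniform (w.bind W) := by
  obtain ⟨k₀, -⟩ := w.support_nonempty
  have hM := card_pos_of_pmf (W k₀)
  have hterm : ∀ k ∈ s, ∀ a, (w k).toReal * ((W k a).toReal *
      Real.log (Fintype.card α * (W k a).toReal)) ≤
      (w k).toReal * (W k a).toReal * Real.log (Fintype.card α * (w.bind W a).toReal) -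
        (w k).toReal * (W k a).toReal * Real.log (w k).toReal := by
    intro k hk a
    rcases (show 0 ≤ (w k).toReal by positivity).eq_or_lt with hw | hw
    · simp [← hw]
    rcases (show 0 ≤ (W k a).toReal by positivity).eq_or_lt with hW | hW
    · simp [← hW]
    have hle : (w k).toReal * (W k a).toReal ≤ (w.bind W a).toReal := by
      rw [toReal_bind_apply w hs]
      exact Finset.single_le_sum (f := fun k => (w k).toReal * (W k a).toReal)
        (fun j _ => by positivity) hk
    rw [← mul_sub, ← mul_assoc]
    gcongr
    rw [le_sub_iff_add_le, ← Real.log_mul (by positivity) (by positivity)]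
    exact Real.log_le_log (by positivity) (by nlinarith)
  have hentropy := neg_sum_mul_log_le w hs
  have := Finset.sum_le_sum fun k hk => Finset.sum_le_sum fun a (_ : a ∈ Finset.univ) =>
    hterm k hk a
  simp only [Finset.sum_sub_distrib, ← Finset.mul_sum, ← Finset.sum_mul, sum_toReal_apply,
    mul_one] at this
  rw [Finset.sum_comm] at this
  simp only [← Finset.sum_mul, ← toReal_bind_apply w hs] at this
  simp only [klUniform]
  linarith

theorem sq_sum_mul_tvUniform_le [DecidableEq ι] [Nonempty ι] (w : PMF κ) {s : Finset κ}
    (hs : w.support ⊆ s) {W : κ → PMF (ι → α)} {D : κ → PMF α}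
    (hD : ∀ k i, (W k).map (fun c => c i) = D k) :
    (∑ k ∈ s, (w k).toReal * tvUniform (D k)) ^ 2 ≤
      (Real.log s.card + tvUniform (w.bind W) *
        (Fintype.card ι * Real.log (Fintype.card α) + 1)) / Fintype.card ι := by
  have hjensen : (∑ k ∈ s, (w k).toReal * tvUniform (D k)) ^ 2 ≤
      ∑ k ∈ s, (w k).toReal * tvUniform (D k) ^ 2 := by
    simpa only [smul_eq_mul] using even_two.convexOn_pow.map_sum_le (t := s)
      (w := fun k => (w k).toReal) (p := fun k => tvUniform (D k))
      (fun k _ => ENNReal.toReal_nonneg) (sum_toReal_apply_of_support_subset w hs)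
      fun k _ => Set.mem_univ _
  have hlog : Real.log (Fintype.card (ι → α)) = Fintype.card ι * Real.log (Fintype.card α) := by
    simp
  rw [le_div_iff₀' (Nat.cast_pos.2 Fintype.card_pos), ← hlog]
  calc Fintype.card ι * (∑ k ∈ s, (w k).toReal * tvUniform (D k)) ^ 2
      ≤ Fintype.card ι * ∑ k ∈ s, (w k).toReal * klUniform (D k) := by
        gcongr
        exact hjensen.trans (Finset.sum_le_sum fun k _ => by
          gcongr
          exact sq_tvUniform_le_klUniform (D k))
    _ = ∑ k ∈ s, (w k).toReal * ∑ i, klUniform ((W k).map fun c => c i) := by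
        simp only [hD, Finset.sum_const, Finset.card_univ, nsmul_eq_mul, Finset.mul_sum,
          mul_left_comm]
    _ ≤ ∑ k ∈ s, (w k).toReal * klUniform (W k) := by
        gcongr with k
        exact sum_klUniform_map_le (W k)
    _ ≤ Real.log s.card + klUniform (w.bind W) := sum_mul_klUniform_le w hs W
    _ ≤ _ := by
        gcongr
        exact klUniform_le_tvUniform_mul _

end Entropy

/-! ### Hypercontractivity of the noise operator -/

theorem two_mul_le_rpow_sub_rpow {r t : ℝ} (hr0 : 0 ≤ r) (hr1 : r ≤ 1) (ht0 : 0 ≤ t)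
    (ht1 : t ≤ 1) : 2 * r * t ≤ (1 + t) ^ r - (1 - t) ^ r := by
  have hmono : MonotoneOn (fun t : ℝ => (1 + t) ^ r - (1 - t) ^ r - 2 * r * t) (Set.Icc 0 1) := by
    refine monotoneOn_of_hasDerivWithinAt_nonneg
      (f' := fun t => r * (1 + t) ^ (r - 1) + r * (1 - t) ^ (r - 1) - 2 * r)
      (convex_Icc 0 1) ?_ ?_ ?_
    · refine Continuous.continuousOn ?_
      have h1 : Continuous fun t : ℝ => (1 + t) ^ r :=
        (by fun_prop : Continuous fun t : ℝ => 1 + t).rpow_const fun _ => Or.inr hr0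
      have h2 : Continuous fun t : ℝ => (1 - t) ^ r :=
        (by fun_prop : Continuous fun t : ℝ => 1 - t).rpow_const fun _ => Or.inr hr0
      exact (h1.sub h2).sub (by fun_prop)
    · intro x hx
      rw [interior_Icc] at hx
      refine HasDerivAt.hasDerivWithinAt ?_
      have h1 : HasDerivAt (fun t : ℝ => (1 + t) ^ r) (1 * r * (1 + x) ^ (r - 1)) x :=
        ((hasDerivAt_id x).const_add 1).rpow_const (Or.inl (by simp only [id]; linarith [hx.1]))
      have h2 : HasDerivAt (fun t : ℝ => (1 - t) ^ r) (-1 * r * (1 - x) ^ (r - 1)) x :=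
        ((hasDerivAt_id x).const_sub 1).rpow_const (Or.inl (by simp only [id]; linarith [hx.2]))
      have h3 : HasDerivAt (fun t : ℝ => 2 * r * t) (2 * r * 1) x :=
        (hasDerivAt_id x).const_mul (2 * r)
      exact ((h1.sub h2).sub h3).congr_deriv (by ring)
    · intro x hx
      rw [interior_Icc] at hx
      have ha : 0 < 1 + x := by linarith [hx.1]
      have hb : 0 < 1 - x := by linarith [hx.2]
      set u := (1 + x) ^ (r - 1)
      set v := (1 - x) ^ (r - 1)
      have hu : 0 < u := Real.rpow_pos_of_pos ha _
      have hv : 0 < v := Real.rpow_pos_of_pos hb _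
      have huv : 1 ≤ u * v := by
        rw [← Real.mul_rpow ha.le hb.le]
        refine Real.one_le_rpow_of_pos_of_le_one_of_nonpos (by positivity) ?_ (by linarith)
        nlinarith [hx.1]
      have : 2 ≤ u + v := by nlinarith [sq_nonneg (u - v)]
      nlinarith
  have := hmono ⟨le_rfl, zero_le_one⟩ ⟨ht0, ht1⟩ ht0
  simp only [add_zero, sub_zero, Real.one_rpow, mul_zero, sub_self] at this
  linarith

theorem one_add_mul_sq_le_rpow_add_rpow {p t : ℝ} (hp1 : 1 ≤ p) (hp2 : p ≤ 2) (ht0 : 0 ≤ t)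
    (ht1 : t ≤ 1) : 1 + p / 2 * ((p - 1) * t ^ 2) ≤ ((1 + t) ^ p + (1 - t) ^ p) / 2 := by
  have hmono : MonotoneOn (fun t : ℝ => (1 + t) ^ p + (1 - t) ^ p - p * (p - 1) * t ^ 2)
      (Set.Icc 0 1) := by
    refine monotoneOn_of_hasDerivWithinAt_nonneg
      (f' := fun t => p * ((1 + t) ^ (p - 1) - (1 - t) ^ (p - 1) - 2 * (p - 1) * t))
      (convex_Icc 0 1) ?_ ?_ ?_
    · refine Continuous.continuousOn ?_
      have h1 : Continuous fun t : ℝ => (1 + t) ^ p :=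
        (by fun_prop : Continuous fun t : ℝ => 1 + t).rpow_const fun _ => Or.inr (by linarith)
      have h2 : Continuous fun t : ℝ => (1 - t) ^ p :=
        (by fun_prop : Continuous fun t : ℝ => 1 - t).rpow_const fun _ => Or.inr (by linarith)
      exact (h1.add h2).sub (by fun_prop)
    · intro x hx
      rw [interior_Icc] at hx
      refine HasDerivAt.hasDerivWithinAt ?_
      have h1 : HasDerivAt (fun t : ℝ => (1 + t) ^ p) (1 * p * (1 + x) ^ (p - 1)) x :=
        ((hasDerivAt_id x).const_add 1).rpow_const (Or.inr hp1)
      have h2 : HasDerivAt (fun t : ℝ => (1 - t) ^ p) (-1 * p * (1 - x) ^ (p - 1)) x :=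
        ((hasDerivAt_id x).const_sub 1).rpow_const (Or.inr hp1)
      have h3 : HasDerivAt (fun t : ℝ => p * (p - 1) * t ^ 2) (p * (p - 1) * (2 * x)) x := by
        simpa using (hasDerivAt_pow 2 x).const_mul (p * (p - 1))
      exact ((h1.add h2).sub h3).congr_deriv (by ring)
    · intro x hx
      rw [interior_Icc] at hx
      have := two_mul_le_rpow_sub_rpow (r := p - 1) (t := x) (by linarith) (by linarith)
        hx.1.le hx.2.le
      exact mul_nonneg (by linarith) (by linarith)
  have := hmono ⟨le_rfl, zero_le_one⟩ ⟨ht0, ht1⟩ ht0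
  simp only [add_zero, sub_zero, Real.one_rpow] at this
  nlinarith

theorem rpow_two_div {x p : ℝ} (hx : 0 ≤ x) (hp : p ≠ 0) : (x ^ p) ^ (2 / p) = x ^ 2 := by
  rw [← Real.rpow_mul hx, mul_div_cancel₀ _ hp, Real.rpow_two]

theorem two_point_of_le_one {ρ t : ℝ} (hρ : ρ ^ 2 ≤ 1) (ht0 : 0 ≤ t) (ht1 : t ≤ 1) :
    1 + ρ ^ 2 * t ^ 2 ≤
      (((1 + t) ^ (1 + ρ ^ 2) + (1 - t) ^ (1 + ρ ^ 2)) / 2) ^ (2 / (1 + ρ ^ 2)) := by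
  set p := 1 + ρ ^ 2
  have hp : 1 ≤ p := le_add_of_nonneg_right (sq_nonneg ρ)
  have hbernoulli : (1 + ρ ^ 2 * t ^ 2) ^ (p / 2) ≤ 1 + p / 2 * (ρ ^ 2 * t ^ 2) :=
    rpow_one_add_le_one_add_mul_self (by nlinarith [mul_nonneg (sq_nonneg ρ) (sq_nonneg t)])
      (by linarith) (by linarith)
  have hseries : 1 + p / 2 * (ρ ^ 2 * t ^ 2) ≤ ((1 + t) ^ p + (1 - t) ^ p) / 2 := by
    simpa [p] using one_add_mul_sq_le_rpow_add_rpow hp (by linarith) ht0 ht1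
  calc 1 + ρ ^ 2 * t ^ 2 = ((1 + ρ ^ 2 * t ^ 2) ^ (p / 2)) ^ (2 / p) := by
        rw [← Real.rpow_mul (by positivity), div_mul_div_cancel₀ (by norm_num),
          div_self (by linarith), Real.rpow_one]
    _ ≤ _ := by
        gcongr
        exact hbernoulli.trans hseries

/-- The hypercontractive inequality on one bit. -/
theorem two_point {ρ x y : ℝ} (hρ : ρ ^ 2 ≤ 1) (hx : 0 ≤ x) (hy : 0 ≤ y) :
    (((1 + ρ) / 2 * x + (1 - ρ) / 2 * y) ^ 2 + ((1 + ρ) / 2 * y + (1 - ρ) / 2 * x) ^ 2) / 2 ≤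
      ((x ^ (1 + ρ ^ 2) + y ^ (1 + ρ ^ 2)) / 2) ^ (2 / (1 + ρ ^ 2)) := by
  wlog hxy : y ≤ x generalizing x y
  · rw [add_comm (x ^ _), add_comm (_ ^ 2)]
    exact this hy hx (by linarith)
  have hp : 0 < 1 + ρ ^ 2 := by positivity
  rcases hx.eq_or_lt with rfl | hx
  · obtain rfl : y = 0 := le_antisymm hxy hy
    norm_num
    positivity
  obtain ⟨s, t, hs, ht0, ht1, rfl, rfl⟩ :
      ∃ s t : ℝ, 0 ≤ s ∧ 0 ≤ t ∧ t ≤ 1 ∧ x = s * (1 + t) ∧ y = s * (1 - t) :=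
    ⟨(x + y) / 2, (x - y) / (x + y), by positivity, div_nonneg (by linarith) (by linarith),
      (div_le_one (by positivity)).2 (by linarith), by field_simp; ring, by field_simp; ring⟩
  have ht : 0 ≤ ((1 + t) ^ (1 + ρ ^ 2) + (1 - t) ^ (1 + ρ ^ 2)) / 2 :=
    div_nonneg (add_nonneg (Real.rpow_nonneg (by linarith) _) (Real.rpow_nonneg (by linarith) _))
      zero_le_two
  calc _ = s ^ 2 * (1 + ρ ^ 2 * t ^ 2) := by ring
    _ ≤ s ^ 2 * (((1 + t) ^ (1 + ρ ^ 2) + (1 - t) ^ (1 + ρ ^ 2)) / 2) ^ (2 / (1 + ρ ^ 2)) := by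
        gcongr
        exact two_point_of_le_one hρ ht0 ht1
    _ = _ := by
        rw [Real.mul_rpow hs (by linarith), Real.mul_rpow hs (by linarith), ← mul_add,
          mul_div_assoc, Real.mul_rpow (by positivity) ht, rpow_two_div hs hp.ne']

/-- The noise operator `f ↦ E[f(N_ρ(·))]`. -/
noncomputable def noiseOp (ρ : unitInterval) {n : ℕ} (f : Word n → ℝ) (c : Word n) : ℝ :=
  ∑ x, (noise ρ c x).toReal * f x

section Noise

variable {n : ℕ} (ρ : unitInterval)

theorem noise_apply (c x : Word n) : noise ρ c x = ∏ i, flipBit ρ (xor (c i) (x i)) := by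
  have hxor : ∀ e : Word n, (fun i => xor (c i) (e i)) = x ↔ e = fun i => xor (c i) (x i) :=
    fun e => by
      simp only [funext_iff]
      exact forall_congr' fun i => by cases c i <;> cases e i <;> cases x i <;> decide
  rw [noise, apply_eq_mean, mean_map]
  simp only [hxor]
  rw [← apply_eq_mean, iid_apply]

theorem sum_word_succ {M : Type*} [AddCommMonoid M] (f : Word (n + 1) → M) :
    ∑ c, f c = (∑ x : Word n, f (Fin.cons true x)) + ∑ x : Word n, f (Fin.cons false x) := by
  rw [← (Fin.consEquiv fun _ : Fin (n + 1) => Bool).sum_comp, Fintype.sum_prod_type,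
    Fintype.sum_bool]
  rfl

theorem expect_word_succ (f : Word (n + 1) → ℝ) :
    𝔼 c, f c = ((𝔼 x : Word n, f (Fin.cons true x)) + 𝔼 x : Word n, f (Fin.cons false x)) / 2 := by
  simp only [Fintype.expect_eq_sum_div_card, sum_word_succ]
  simp [pow_succ]
  ring

theorem noiseOp_zero (f : Word 0 → ℝ) (c : Word 0) : noiseOp ρ f c = f c := by
  simp only [noiseOp, Fintype.sum_subsingleton _ c]
  simp [noise_apply]

theorem noiseOp_succ (f : Word (n + 1) → ℝ) (b : Bool) (c : Word n) :
    noiseOp ρ f (Fin.cons b c) = (1 + ρ) / 2 * noiseOp ρ (fun x => f (Fin.cons b x)) c +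
      (1 - ρ) / 2 * noiseOp ρ (fun x => f (Fin.cons (!b) x)) c := by
  have h0 := ρ.2.1
  have h1 := ρ.2.2
  have hfalse : (flipBit ρ false).toReal = (1 + ρ) / 2 := by
    simp [flipBit, ENNReal.toReal_ofReal (show 0 ≤ (1 + (ρ : ℝ)) / 2 by linarith)]
  have htrue : (flipBit ρ true).toReal = (1 - ρ) / 2 := by
    simp [flipBit, ENNReal.toReal_ofReal (show 0 ≤ (1 - (ρ : ℝ)) / 2 by linarith)]
  simp only [noiseOp, sum_word_succ, noise_apply, Fin.prod_univ_succ, Fin.cons_zero, Fin.cons_succ,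
    ENNReal.toReal_mul, mul_assoc, ← Finset.mul_sum]
  cases b <;> simp [hfalse, htrue, add_comm]

theorem noiseOp_nonneg {f : Word n → ℝ} (hf : ∀ x, 0 ≤ f x) (c : Word n) : 0 ≤ noiseOp ρ f c :=
  Finset.sum_nonneg fun x _ => mul_nonneg ENNReal.toReal_nonneg (hf x)

theorem noiseOp_le_one {f : Word n → ℝ} (hf : ∀ x, f x ≤ 1) (c : Word n) : noiseOp ρ f c ≤ 1 :=
  (Finset.sum_le_sum fun x _ => mul_le_of_le_one_right ENNReal.toReal_nonneg (hf x)).trans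
    (sum_toReal_apply (noise ρ c)).le

end Noise

/-- Minkowski's inequality. -/
theorem expect_add_rpow_le {ι : Type*} [Fintype ι] {r a b : ℝ} (hr : 1 ≤ r) {u v : ι → ℝ}
    (hu : ∀ i, 0 ≤ u i) (hv : ∀ i, 0 ≤ v i) (ha : 0 ≤ a) (hb : 0 ≤ b)
    (hua : 𝔼 i, u i ^ r ≤ a ^ r) (hvb : 𝔼 i, v i ^ r ≤ b ^ r) :
    𝔼 i, (u i + v i) ^ r ≤ (a + b) ^ r := by
  cases isEmpty_or_nonempty ι
  · simp only [Finset.univ_eq_empty, Finset.expect_empty]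
    positivity
  have hr0 : 0 < r := zero_lt_one.trans_le hr
  have hM : (0 : ℝ) < Fintype.card ι := Nat.cast_pos.2 Fintype.card_pos
  simp only [Fintype.expect_eq_sum_div_card, div_le_iff₀' hM] at hua hvb ⊢
  set M : ℝ := (Fintype.card ι : ℝ)
  have hM' : M = (M ^ (1 / r)) ^ r := by
    rw [← Real.rpow_mul hM.le, one_div_mul_cancel hr0.ne', Real.rpow_one]
  have hroot : ∀ {w : ι → ℝ} {d : ℝ}, (∀ i, 0 ≤ w i) → 0 ≤ d → ∑ i, w i ^ r ≤ M * d ^ r →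
      (∑ i, w i ^ r) ^ (1 / r) ≤ M ^ (1 / r) * d := fun {w d} hw hd h => by
    rw [one_div, Real.rpow_inv_le_iff_of_pos
      (Finset.sum_nonneg fun i _ => Real.rpow_nonneg (hw i) r) (by positivity) hr0,
      Real.mul_rpow (by positivity) hd, ← one_div, ← hM']
    exact h
  have hminkowski := Real.Lp_add_le_of_nonneg (s := Finset.univ) hr (fun i _ => hu i)
    fun i _ => hv i
  have hsum := hminkowski.trans (add_le_add (hroot hu ha hua) (hroot hv hb hvb))
  rw [← mul_add, one_div, Real.rpow_inv_le_iff_of_pos (Finset.sum_nonneg fun i _ =>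
    Real.rpow_nonneg (add_nonneg (hu i) (hv i)) r) (by positivity) hr0,
    Real.mul_rpow (by positivity) (by positivity), ← one_div, ← hM'] at hsum
  exact hsum

section Hypercontractivity

variable {n : ℕ} (ρ : unitInterval)

/-- The Bonami–Beckner inequality `‖T_ρ f‖₂ ≤ ‖f‖_{1+ρ²}` for nonnegative `f`. -/
theorem hypercontractive {f : Word n → ℝ} (hf : ∀ x, 0 ≤ f x) :
    𝔼 c, noiseOp ρ f c ^ 2 ≤
      (𝔼 x, f x ^ (1 + (ρ : ℝ) ^ 2)) ^ (2 / (1 + (ρ : ℝ) ^ 2)) := by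
  have hρ : (ρ : ℝ) ^ 2 ≤ 1 := pow_le_one₀ ρ.2.1 ρ.2.2
  have hp : 0 < 1 + (ρ : ℝ) ^ 2 := by positivity
  have hr : 1 ≤ 2 / (1 + (ρ : ℝ) ^ 2) := by
    rw [le_div_iff₀ hp]
    linarith
  induction n with
  | zero =>
    simp only [noiseOp_zero, Fintype.expect_eq_sum_div_card, Fintype.card_unique, Nat.cast_one,
      div_one, Fintype.sum_unique]
    rw [rpow_two_div (hf _) hp.ne']
  | succ n ih =>
    have hA := noiseOp_nonneg ρ fun x => hf (Fin.cons true x)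
    have hB := noiseOp_nonneg ρ fun x => hf (Fin.cons false x)
    have ihA := ih fun x => hf (Fin.cons true x)
    have ihB := ih fun x => hf (Fin.cons false x)
    simp only [expect_word_succ, noiseOp_succ, Bool.not_true, Bool.not_false]
    set A := noiseOp ρ fun x => f (Fin.cons true x)
    set B := noiseOp ρ fun x => f (Fin.cons false x)
    set a := 𝔼 x : Word n, f (Fin.cons true x) ^ (1 + (ρ : ℝ) ^ 2)
    set b := 𝔼 x : Word n, f (Fin.cons false x) ^ (1 + (ρ : ℝ) ^ 2)
    have ha : 0 ≤ a := Finset.expect_nonneg fun x _ => Real.rpow_nonneg (hf _) _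
    have hb : 0 ≤ b := Finset.expect_nonneg fun x _ => Real.rpow_nonneg (hf _) _
    set p := 1 + (ρ : ℝ) ^ 2
    have hAp : ∀ x, 0 ≤ A x ^ p := fun x => Real.rpow_nonneg (hA x) p
    have hBp : ∀ x, 0 ≤ B x ^ p := fun x => Real.rpow_nonneg (hB x) p
    calc _ = 𝔼 x, (((1 + ρ) / 2 * A x + (1 - ρ) / 2 * B x) ^ 2 +
          ((1 + ρ) / 2 * B x + (1 - ρ) / 2 * A x) ^ 2) / 2 := by
          rw [← Finset.expect_add_distrib, Finset.expect_div]
      _ ≤ 𝔼 x, ((A x ^ p + B x ^ p) / 2) ^ (2 / p) :=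
          Finset.expect_le_expect fun x _ => two_point hρ (hA x) (hB x)
      _ = (𝔼 x, (A x ^ p + B x ^ p) ^ (2 / p)) / 2 ^ (2 / p) := by
          simp only [Real.div_rpow (add_nonneg (hAp _) (hBp _)) zero_le_two, Finset.expect_div]
      _ ≤ (a + b) ^ (2 / p) / 2 ^ (2 / p) := by
          gcongr
          refine expect_add_rpow_le hr hAp hBp ha hb ?_ ?_
          · simpa only [rpow_two_div (hA _) hp.ne'] using ihA
          · simpa only [rpow_two_div (hB _) hp.ne'] using ihB
      _ = ((a + b) / 2) ^ (2 / p) := (Real.div_rpow (add_nonneg ha hb) zero_le_two _).symm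

theorem expect_sq_noiseOp_le {f : Word n → ℝ} {τ : ℝ} (hf0 : ∀ x, 0 ≤ f x) (hf1 : ∀ x, f x ≤ 1)
    (hfτ : 𝔼 x, f x ≤ τ) :
    𝔼 c, noiseOp ρ f c ^ 2 ≤
      (𝔼 x, f x) * τ ^ ((1 - (ρ : ℝ) ^ 2) / (1 + (ρ : ℝ) ^ 2)) := by
  have hρ : (ρ : ℝ) ^ 2 ≤ 1 := pow_le_one₀ ρ.2.1 ρ.2.2
  have hp : 0 < 1 + (ρ : ℝ) ^ 2 := by positivity
  have hα : 0 ≤ (1 - (ρ : ℝ) ^ 2) / (1 + (ρ : ℝ) ^ 2) := div_nonneg (by linarith) hp.le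
  have hmean : 0 ≤ 𝔼 x, f x := Finset.expect_nonneg fun x _ => hf0 x
  calc 𝔼 c, noiseOp ρ f c ^ 2
      ≤ (𝔼 x, f x ^ (1 + (ρ : ℝ) ^ 2)) ^ (2 / (1 + (ρ : ℝ) ^ 2)) := hypercontractive ρ hf0
    _ ≤ (𝔼 x, f x) ^ (2 / (1 + (ρ : ℝ) ^ 2)) := by
        gcongr with x
        · exact Finset.expect_nonneg fun x _ => Real.rpow_nonneg (hf0 x) _
        · exact Real.rpow_le_self_of_le_one (hf0 x) (hf1 x) (by nlinarith)
    _ = (𝔼 x, f x) ^ (1 + (1 - (ρ : ℝ) ^ 2) / (1 + (ρ : ℝ) ^ 2)) := by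
        congr 1
        field_simp
        ring
    _ = (𝔼 x, f x) * (𝔼 x, f x) ^ ((1 - (ρ : ℝ) ^ 2) / (1 + (ρ : ℝ) ^ 2)) := by
        rw [Real.rpow_add_of_nonneg hmean zero_le_one hα, Real.rpow_one]
    _ ≤ _ := by gcongr

section LightCollision

variable {ι : Type*} [Fintype ι] {Q τ : ℝ} {G f : ι → Word n → ℝ}

/-- `G y c` and `f y c` stand for the probabilities that two algorithms with at most `Q` queries
ask `y` on input `c`. -/
theorem light_collision (hG0 : ∀ y c, 0 ≤ G y c) (hG1 : ∀ y c, G y c ≤ 1)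
    (hGQ : ∀ c, ∑ y, G y c ≤ Q) (hf0 : ∀ y c, 0 ≤ f y c) (hf1 : ∀ y c, f y c ≤ 1)
    (hfQ : ∀ c, ∑ y, f y c ≤ Q) (hτ : 0 ≤ τ) (hfτ : ∀ y, 𝔼 x, f y x ≤ τ) :
    𝔼 c, ∑ y, G y c * noiseOp ρ (f y) c ≤
      Q * τ ^ ((1 / 2 : ℝ) * ((1 - (ρ : ℝ) ^ 2) / (1 + (ρ : ℝ) ^ 2))) := by
  set α := (1 - (ρ : ℝ) ^ 2) / (1 + (ρ : ℝ) ^ 2)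
  have hQ : 0 ≤ Q := (Finset.sum_nonneg fun y _ => hG0 y default).trans (hGQ default)
  have hQavg : ∀ {h : Word n → ℝ}, (∀ c, h c ≤ Q) → 𝔼 c, h c ≤ Q := fun hh =>
    (Finset.expect_le_expect fun c _ => hh c).trans (Fintype.expect_const Q).le
  have hGsq : 𝔼 c, ∑ y, G y c ^ 2 ≤ Q := hQavg fun c =>
    (Finset.sum_le_sum fun y _ => pow_le_of_le_one (hG0 y c) (hG1 y c) two_ne_zero).trans (hGQ c)
  have hfsq : 𝔼 c, ∑ y, noiseOp ρ (f y) c ^ 2 ≤ Q * τ ^ α := by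
    calc 𝔼 c, ∑ y, noiseOp ρ (f y) c ^ 2 = ∑ y, 𝔼 c, noiseOp ρ (f y) c ^ 2 :=
          Finset.expect_sum_comm _ _ _
      _ ≤ ∑ y, (𝔼 x, f y x) * τ ^ α :=
          Finset.sum_le_sum fun y _ => expect_sq_noiseOp_le ρ (hf0 y) (hf1 y) (hfτ y)
      _ = (𝔼 c, ∑ y, f y c) * τ ^ α := by rw [← Finset.sum_mul, Finset.expect_sum_comm]
      _ ≤ Q * τ ^ α := by
          gcongr
          exact hQavg hfQ
  have hcauchy : (𝔼 c, ∑ y, G y c * noiseOp ρ (f y) c) ^ 2 ≤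
      (𝔼 c, ∑ y, G y c ^ 2) * 𝔼 c, ∑ y, noiseOp ρ (f y) c ^ 2 := by
    simp only [Fintype.expect_eq_sum_div_card, ← Fintype.sum_prod_type', div_pow,
      div_mul_div_comm, ← sq]
    gcongr
    exact Finset.sum_mul_sq_le_sq_mul_sq _ _ _
  have hτα : τ ^ α = (τ ^ (1 / 2 * α)) ^ 2 := by
    rw [← Real.rpow_mul_natCast hτ]
    congr 1
    push_cast
    ring
  refine (sq_le_sq₀ ?_ (by positivity)).1 ?_
  · exact Finset.expect_nonneg fun c _ => Finset.sum_nonneg fun y _ =>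
      mul_nonneg (hG0 y c) (noiseOp_nonneg ρ (hf0 y) c)
  calc _ ≤ Q * (Q * τ ^ α) := by
        refine hcauchy.trans (mul_le_mul hGsq hfsq ?_ hQ)
        exact Finset.expect_nonneg fun c _ => Finset.sum_nonneg fun y _ => sq_nonneg _
    _ = (Q * τ ^ (1 / 2 * α)) ^ 2 := by
        rw [hτα]
        ring

theorem light_collision_of_pmf (D : PMF (Word n)) (hG0 : ∀ y c, 0 ≤ G y c)
    (hG1 : ∀ y c, G y c ≤ 1) (hGQ : ∀ c, ∑ y, G y c ≤ Q) (hf0 : ∀ y c, 0 ≤ f y c)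
    (hf1 : ∀ y c, f y c ≤ 1) (hfQ : ∀ c, ∑ y, f y c ≤ Q) (hτ : 0 ≤ τ)
    (hfτ : ∀ y, 𝔼 x, f y x ≤ τ) :
    ∑ c, (D c).toReal * ∑ y, G y c * noiseOp ρ (f y) c ≤
      Q * τ ^ ((1 / 2 : ℝ) * ((1 - (ρ : ℝ) ^ 2) / (1 + (ρ : ℝ) ^ 2))) + Q * tvUniform D := by
  refine le_trans ?_ (add_le_add (light_collision ρ hG0 hG1 hGQ hf0 hf1 hfQ hτ hfτ)
    (le_refl (Q * tvUniform D)))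
  rw [Fintype.expect_eq_sum_div_card, Finset.sum_div, tvUniform, Finset.mul_sum,
    ← Finset.sum_add_distrib]
  refine Finset.sum_le_sum fun c _ => ?_
  set s := ∑ y, G y c * noiseOp ρ (f y) c
  have hs0 : 0 ≤ s :=
    Finset.sum_nonneg fun y _ => mul_nonneg (hG0 y c) (noiseOp_nonneg ρ (hf0 y) c)
  have hsQ : s ≤ Q :=
    (Finset.sum_le_sum fun y _ =>
      mul_le_of_le_one_right (hG0 y c) (noiseOp_le_one ρ (hf1 y) c)).trans (hGQ c)
  set u : ℝ := (Fintype.card (Word n) : ℝ)⁻¹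
  calc (D c).toReal * s ≤ (u + max ((D c).toReal - u) 0) * s := by
        gcongr
        linarith [le_max_left ((D c).toReal - u) 0]
    _ ≤ s / Fintype.card (Word n) + Q * max ((D c).toReal - u) 0 := by
        rw [add_mul, div_eq_inv_mul, mul_comm (max _ _)]
        gcongr

theorem light_collision_of_joint (D : PMF (Word n)) (hG0 : ∀ y c, 0 ≤ G y c)
    (hGD : ∀ y c, G y c ≤ (D c).toReal) (hGQ : ∀ c, ∑ y, G y c ≤ Q * (D c).toReal) (hQ : 0 ≤ Q)
    (hf0 : ∀ y c, 0 ≤ f y c) (hf1 : ∀ y c, f y c ≤ 1) (hfQ : ∀ c, ∑ y, f y c ≤ Q) (hτ : 0 ≤ τ)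
    (hfτ : ∀ y, 𝔼 x, f y x ≤ τ) :
    ∑ c, ∑ y, G y c * noiseOp ρ (f y) c ≤
      Q * τ ^ ((1 / 2 : ℝ) * ((1 - (ρ : ℝ) ^ 2) / (1 + (ρ : ℝ) ^ 2))) + Q * tvUniform D := by
  have hD0 : ∀ c, 0 ≤ (D c).toReal := fun c => ENNReal.toReal_nonneg
  have hcancel : ∀ y c, (D c).toReal * (G y c / (D c).toReal) = G y c := fun y c =>
    mul_div_cancel_of_imp' fun h => le_antisymm (h ▸ hGD y c) (hG0 y c)
  refine le_trans (le_of_eq ?_) (light_collision_of_pmf ρ D (G := fun y c => G y c / (D c).toReal)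
    (fun y c => div_nonneg (hG0 y c) (hD0 c)) (fun y c => div_le_one_of_le₀ (hGD y c) (hD0 c))
    (fun c => ?_) hf0 hf1 hfQ hτ hfτ)
  · simp only [Finset.mul_sum, ← mul_assoc, hcancel]
  · rw [← Finset.sum_div]
    exact div_le_of_le_mul₀ (hD0 c) hQ (hGQ c)

end LightCollision

end Hypercontractivity

/-! ### Random finite sets -/

/-- The probability that the random set `A` contains `y`. -/
noncomputable def hitProb {ι : Type*} [DecidableEq ι] (A : PMF (Finset ι)) (y : ι) : ℝ≥0∞ :=
  mean A fun s => if y ∈ s then 1 else 0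

section HitProb

variable {ι α : Type*} [DecidableEq ι]

theorem ite_le_one (p : Prop) [Decidable p] : (if p then (1 : ℝ≥0∞) else 0) ≤ 1 := by
  split_ifs
  exacts [le_rfl, zero_le_one]

theorem hitProb_le_one (A : PMF (Finset ι)) (y : ι) : hitProb A y ≤ 1 :=
  mean_le_of_forall_le fun _ _ => ite_le_one _

theorem hitProb_ne_top (A : PMF (Finset ι)) (y : ι) : hitProb A y ≠ ⊤ :=
  ne_top_of_le_ne_top ENNReal.one_ne_top (hitProb_le_one A y)

theorem toReal_hitProb_le_one (A : PMF (Finset ι)) (y : ι) : (hitProb A y).toReal ≤ 1 :=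
  ENNReal.toReal_mono ENNReal.one_ne_top (hitProb_le_one A y)

theorem hitProb_bind (p : PMF α) (A : α → PMF (Finset ι)) (y : ι) :
    hitProb (p.bind A) y = mean p fun a => hitProb (A a) y := mean_bind _ _ _

theorem sum_hitProb_le [Fintype ι] {A : PMF (Finset ι)} {Q : ℕ}
    (hA : ∀ s ∈ A.support, s.card ≤ Q) : ∑ y, hitProb A y ≤ Q := by
  simp only [hitProb, ← mean_sum]
  refine mean_le_of_forall_le fun s hs => ?_
  simpa using hA s hs

theorem sum_toReal_hitProb_le [Fintype ι] {A : PMF (Finset ι)} {Q : ℕ}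
    (hA : ∀ s ∈ A.support, s.card ≤ Q) : ∑ y, (hitProb A y).toReal ≤ Q := by
  rw [← ENNReal.toReal_sum fun y _ => hitProb_ne_top A y]
  exact ENNReal.toReal_mono (ENNReal.natCast_ne_top Q) (sum_hitProb_le hA)

theorem mean_notMem_eq (A : PMF (Finset ι)) (y : ι) :
    (mean A fun s => if y ∈ s then 0 else 1) = ENNReal.ofReal (1 - (hitProb A y).toReal) := by
  have hsum : (mean A fun s => if y ∈ s then 0 else 1) + hitProb A y = 1 := by
    rw [hitProb, ← mean_add]
    exact (mean_congr fun s _ => by split_ifs <;> simp).trans (mean_const A 1)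
  rw [ENNReal.ofReal_sub _ ENNReal.toReal_nonneg, ENNReal.ofReal_one,
    ENNReal.ofReal_toReal (hitProb_ne_top A y)]
  exact ENNReal.eq_sub_of_add_eq (hitProb_ne_top A y) hsum

end HitProb

theorem one_sub_pow_ceil_le {k : ℕ} {τ h : ℝ} (hτ : 0 < τ) (hh : τ ≤ h) (hh1 : h ≤ 1) :
    (1 - h) ^ ⌈k / τ⌉₊ ≤ (2⁻¹ : ℝ) ^ k := by
  have hhalf : Real.exp (-1) ≤ 2⁻¹ := by
    rw [Real.exp_neg]
    exact inv_anti₀ (by norm_num) (by linarith [Real.add_one_le_exp 1])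
  calc (1 - h) ^ ⌈k / τ⌉₊ ≤ Real.exp (-τ) ^ ⌈k / τ⌉₊ := by
        gcongr
        exact (sub_le_sub_left hh 1).trans (Real.one_sub_le_exp_neg τ)
    _ = Real.exp (⌈k / τ⌉₊ * -τ) := (Real.exp_nat_mul _ _).symm
    _ ≤ Real.exp (k * -1) := by
        refine Real.exp_le_exp.2 ?_
        linarith [(div_le_iff₀ hτ).1 (Nat.le_ceil (k / τ))]
    _ = Real.exp (-1) ^ k := Real.exp_nat_mul _ _
    _ ≤ 2⁻¹ ^ k := by gcongr

section Samples

variable {ι : Type} [DecidableEq ι]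

theorem mean_iid_notMem_le {A : PMF (Finset ι)} {y : ι} {τ : ℝ} (hτ : 0 < τ)
    (hy : τ ≤ (hitProb A y).toReal) (k : ℕ) :
    (mean (iid A ⌈k / τ⌉₊) fun v => ∏ i, if y ∈ v i then 0 else 1) ≤
      hitProb A y * ENNReal.ofReal ((2⁻¹ : ℝ) ^ k / τ) := by
  have hle := toReal_hitProb_le_one A y
  rw [mean_iid_prod A _ fun s => if y ∈ s then 0 else 1, mean_notMem_eq,
    ← ENNReal.ofReal_pow (by linarith)]
  nth_rewrite 2 [← ENNReal.ofReal_toReal (hitProb_ne_top A y)]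
  rw [← ENNReal.ofReal_mul ENNReal.toReal_nonneg]
  refine ENNReal.ofReal_le_ofReal ((one_sub_pow_ceil_le hτ hy hle).trans ?_)
  rw [← mul_div_assoc, le_div_iff₀ hτ, mul_comm]
  gcongr

open scoped Classical in
theorem mean_iid_exists_notMem_le [Fintype ι] {A : PMF (Finset ι)} {Q : ℕ}
    (hA : ∀ s ∈ A.support, s.card ≤ Q) {τ : ℝ} (hτ : 0 < τ) (k : ℕ) :
    (mean (iid A ⌈k / τ⌉₊) fun v =>
      if ∃ y, τ ≤ (hitProb A y).toReal ∧ ∀ i, y ∉ v i then 1 else 0) ≤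
      ENNReal.ofReal ((2⁻¹ : ℝ) ^ k * Q / τ) := by
  calc _ ≤ mean (iid A ⌈k / τ⌉₊) fun v => ∑ y, if τ ≤ (hitProb A y).toReal then
          ∏ i, (if y ∈ v i then 0 else 1) else 0 := by
        refine mean_mono fun v _ => ?_
        split_ifs with hv
        · obtain ⟨y, hy, hyv⟩ := hv
          refine le_trans ?_ (Finset.single_le_sum (fun _ _ => zero_le) (Finset.mem_univ y))
          rw [if_pos hy, Finset.prod_eq_one fun i _ => if_neg (hyv i)]
        · exact zero_le
    _ ≤ ∑ y, hitProb A y * ENNReal.ofReal ((2⁻¹ : ℝ) ^ k / τ) := by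
        rw [mean_sum]
        refine Finset.sum_le_sum fun y _ => ?_
        split_ifs with hy
        · exact mean_iid_notMem_le hτ hy k
        · exact (mean_const _ _).trans_le zero_le
    _ ≤ Q * ENNReal.ofReal ((2⁻¹ : ℝ) ^ k / τ) := by
        rw [← Finset.sum_mul]
        gcongr
        exact sum_hitProb_le hA
    _ = ENNReal.ofReal ((2⁻¹ : ℝ) ^ k * Q / τ) := by
        rw [← ENNReal.ofReal_natCast, ← ENNReal.ofReal_mul (Nat.cast_nonneg _)]
        congr 1
        ring

end Samples

section Collision

variable {n : ℕ} {ι : Type*} [DecidableEq ι] (ρ : unitInterval) {Q : ℕ}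

theorem mean_noise_hitProb (B : Word n → PMF (Finset ι)) (c : Word n) (y : ι) :
    (mean (noise ρ c) fun x => hitProb (B x) y) =
      ENNReal.ofReal (noiseOp ρ (fun x => (hitProb (B x) y).toReal) c) := by
  rw [noiseOp, ← mean_ofReal _ fun _ => ENNReal.toReal_nonneg]
  simp only [ENNReal.ofReal_toReal (hitProb_ne_top _ y)]

theorem mean_uniformOfFintype_hitProb (B : Word n → PMF (Finset ι)) (y : ι) :
    (mean (PMF.uniformOfFintype (Word n)) fun x => hitProb (B x) y) =
      ENNReal.ofReal (𝔼 x, (hitProb (B x) y).toReal) := by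
  rw [Fintype.expect_eq_sum_div_card, div_eq_inv_mul, Finset.mul_sum]
  simpa [ENNReal.ofReal_toReal (hitProb_ne_top _ y)] using
    mean_ofReal (PMF.uniformOfFintype (Word n)) (f := fun x => (hitProb (B x) y).toReal)
      fun _ => ENNReal.toReal_nonneg

theorem toReal_map_fst_apply {α β : Type*} [Fintype β] (E : PMF (α × β)) (a : α) :
    (E.map Prod.fst a).toReal = ∑ b, (E (a, b)).toReal := by
  classical
  rw [PMF.map_apply, ENNReal.tsum_prod', tsum_eq_single a fun a' ha => by simp [ha.symm],
    tsum_fintype]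
  simp [ENNReal.toReal_sum fun b _ => E.apply_ne_top (a, b)]

theorem sum_mem_mul_noiseOp_le [Fintype ι]
    {E : PMF (Word n × Finset ι)} (hE : ∀ z ∈ E.support, z.2.card ≤ Q)
    {B : Word n → PMF (Finset ι)} (hB : ∀ x, ∀ s ∈ (B x).support, s.card ≤ Q) {τ : ℝ}
    (hτ : 0 ≤ τ) (hlight : ∀ y, hitProb ((PMF.uniformOfFintype (Word n)).bind B) y ≤
      ENNReal.ofReal τ) :
    ∑ z, (E z).toReal *
      ∑ y, (if y ∈ z.2 then 1 else 0) * noiseOp ρ (fun x => (hitProb (B x) y).toReal) z.1 ≤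
      Q * τ ^ ((1 / 2 : ℝ) * ((1 - (ρ : ℝ) ^ 2) / (1 + (ρ : ℝ) ^ 2))) +
        Q * tvUniform (E.map Prod.fst) := by
  refine le_trans (le_of_eq ?_) (light_collision_of_joint ρ (E.map Prod.fst)
    (G := fun y c => ∑ s, (E (c, s)).toReal * if y ∈ s then 1 else 0)
    (f := fun y x => (hitProb (B x) y).toReal) (fun y c => ?_) (fun y c => ?_) (fun c => ?_)
    (Nat.cast_nonneg Q) (fun _ _ => ENNReal.toReal_nonneg) (fun y x => toReal_hitProb_le_one _ y)
    (fun x => sum_toReal_hitProb_le (hB x)) hτ fun y => ?_)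
  · simp only [Fintype.sum_prod_type, Finset.mul_sum, Finset.sum_mul, mul_assoc]
    exact Finset.sum_congr rfl fun c _ => Finset.sum_comm
  · positivity
  · rw [toReal_map_fst_apply]
    gcongr with s
    exact mul_le_of_le_one_right ENNReal.toReal_nonneg (by split_ifs <;> norm_num)
  · rw [toReal_map_fst_apply, Finset.sum_comm, Finset.mul_sum]
    refine Finset.sum_le_sum fun s _ => ?_
    rw [← Finset.mul_sum, mul_comm]
    rcases eq_or_ne (E (c, s)) 0 with h | h
    · simp [h]
    · gcongr
      simpa using hE (c, s) ((E.mem_support_iff _).2 h)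
  · have := hlight y
    rwa [hitProb_bind, mean_uniformOfFintype_hitProb, ENNReal.ofReal_le_ofReal_iff hτ] at this

open scoped Classical in
theorem mean_collision_le [Finite ι]
    {E : PMF (Word n × Finset ι)} (hE : ∀ z ∈ E.support, z.2.card ≤ Q)
    {B : Word n → PMF (Finset ι)} (hB : ∀ x, ∀ s ∈ (B x).support, s.card ≤ Q) {τ : ℝ}
    (hτ : 0 ≤ τ) (hlight : ∀ y, hitProb ((PMF.uniformOfFintype (Word n)).bind B) y ≤
      ENNReal.ofReal τ) :
    (mean E fun z => mean ((noise ρ z.1).bind B) fun s => if ∃ y ∈ z.2, y ∈ s then 1 else 0) ≤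
      ENNReal.ofReal (Q * τ ^ ((1 / 2 : ℝ) * ((1 - (ρ : ℝ) ^ 2) / (1 + (ρ : ℝ) ^ 2))) +
        Q * tvUniform (E.map Prod.fst)) := by
  have := Fintype.ofFinite ι
  have hnoise : ∀ y c, 0 ≤ noiseOp ρ (fun x => (hitProb (B x) y).toReal) c := fun y =>
    noiseOp_nonneg ρ fun _ => ENNReal.toReal_nonneg
  calc _ ≤ mean E fun z => ∑ y, (if y ∈ z.2 then 1 else 0) *
          hitProb ((noise ρ z.1).bind B) y := by
        refine mean_mono fun z _ => ?_
        simp only [hitProb, ← mean_const_mul, ← mean_sum]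
        refine mean_mono fun s _ => ?_
        split_ifs with h
        · obtain ⟨y, hy, hys⟩ := h
          refine le_trans ?_ (Finset.single_le_sum (fun _ _ => zero_le) (Finset.mem_univ y))
          simp [hy, hys]
        · exact zero_le
    _ = mean E fun z => ENNReal.ofReal (∑ y, (if y ∈ z.2 then 1 else 0) *
          noiseOp ρ (fun x => (hitProb (B x) y).toReal) z.1) := by
        refine mean_congr fun z _ => ?_
        rw [ENNReal.ofReal_sum_of_nonneg fun y _ => mul_nonneg (by positivity) (hnoise y z.1)]
        refine Finset.sum_congr rfl fun y _ => ?_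
        rw [hitProb_bind, mean_noise_hitProb, ENNReal.ofReal_mul (by positivity)]
        split_ifs <;> simp
    _ ≤ _ := by
        rw [mean_ofReal E fun z => Finset.sum_nonneg fun y _ =>
          mul_nonneg (by positivity) (hnoise y z.1)]
        exact ENNReal.ofReal_le_ofReal (sum_mem_mul_noiseOp_le ρ hE hB hτ hlight)

end Collision

/-! ### Random oracles -/

theorem mean_uniformOfFintype_piecewise {X Y : Type*} [Fintype X] [DecidableEq X] [Fintype Y]
    [Nonempty Y] {D : (X → Y) → Finset X} (hD : ∀ F F', (∀ x ∈ D F, F' x = F x) → D F' = D F)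
    (ψ : (X → Y) → ℝ≥0∞) :
    (mean (PMF.uniformOfFintype (X → Y)) fun F => mean (PMF.uniformOfFintype (X → Y)) fun G =>
      ψ ((D F).piecewise F G)) = mean (PMF.uniformOfFintype (X → Y)) ψ := by
  let swap : (X → Y) × (X → Y) → (X → Y) × (X → Y) := fun z =>
    ((D z.1).piecewise z.1 z.2, (D z.1).piecewise z.2 z.1)
  have hswap : Function.Involutive swap := by
    rintro ⟨F, G⟩
    have hDF : D ((D F).piecewise F G) = D F :=
      hD _ _ fun x hx => Finset.piecewise_eq_of_mem _ _ _ hx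
    refine Prod.ext (funext fun x => ?_) (funext fun x => ?_) <;> simp only [swap, hDF] <;>
      by_cases hx : x ∈ D F <;> simp [hx]
  have hsum : ∑ F, ∑ G, ψ ((D F).piecewise F G) = ∑ F, ∑ _ : X → Y, ψ F := by
    simp only [← Fintype.sum_prod_type']
    exact Equiv.sum_comp (hswap.toPerm swap) fun z => ψ z.1
  calc _ = mean (PMF.uniformOfFintype (X → Y)) fun F =>
        mean (PMF.uniformOfFintype (X → Y)) fun _ => ψ F := by
          simp only [mean_uniformOfFintype, ← Finset.mul_sum, hsum]
    _ = _ := by simp only [mean_const]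

section Tables

variable {lam : ℕ}

/-- The points at which the table `S` records a value. -/
def points (S : List (Word lam × Bool)) : Finset (Word lam) :=
  (S.map Prod.fst).toFinset

theorem mem_points {S : List (Word lam × Bool)} {x : Word lam} :
    x ∈ points S ↔ ∃ b, (x, b) ∈ S := by
  simp [points]

theorem card_points_le (S : List (Word lam × Bool)) : (points S).card ≤ S.length :=
  (List.toFinset_card_le _).trans_eq (S.length_map _)

/-- The oracle that answers as recorded in `S`, and like `G` elsewhere. -/
def fill (S : List (Word lam × Bool)) (G : Oracle lam) : Oracle lam :=
  fun x => (S.lookup x).getD (G x)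

theorem mean_consistentOracle (S : List (Word lam × Bool)) (f : Oracle lam → ℝ≥0∞) :
    mean (consistentOracle S) f = mean (PMF.uniformOfFintype (Oracle lam)) fun G => f (fill S G) :=
  mean_map _ _ _

theorem fill_of_notMem {S : List (Word lam × Bool)} {x : Word lam} (hx : x ∉ points S)
    (G : Oracle lam) : fill S G x = G x := by
  have hnone : S.lookup x = none :=
    List.lookup_eq_none_iff.2 fun z hz =>
      bne_iff_ne.2 fun h => hx (mem_points.2 ⟨z.2, h ▸ hz⟩)
  rw [fill, hnone, Option.getD_none]

theorem exists_fill_eq {S : List (Word lam × Bool)} {x : Word lam} (hx : x ∈ points S) :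
    ∃ b, (x, b) ∈ S ∧ ∀ G, fill S G x = b := by
  obtain ⟨b, hb⟩ := mem_points.1 hx
  obtain ⟨b', hb'⟩ := Option.isSome_iff_exists.1
    (List.lookup_isSome_iff.2 ⟨(x, b), hb, beq_self_eq_true x⟩)
  obtain ⟨l₁, l₂, hS, -⟩ := List.lookup_eq_some_iff.1 hb'
  exact ⟨b', by simp [hS], fun G => by rw [fill, hb', Option.getD_some]⟩

theorem fill_eq_fill {S : List (Word lam × Bool)} {x : Word lam} {G G' : Oracle lam}
    (h : x ∉ points S → G x = G' x) : fill S G x = fill S G' x := by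
  by_cases hx : x ∈ points S
  · obtain ⟨b, -, hb⟩ := exists_fill_eq hx
    rw [hb, hb]
  · rw [fill_of_notMem hx, fill_of_notMem hx, h hx]

theorem fill_piecewise (S : List (Word lam × Bool)) (s : Finset (Word lam)) (G G' : Oracle lam) :
    fill S (s.piecewise G G') = s.piecewise (fill S G) (fill S G') := by
  ext1 x
  by_cases hx : x ∈ s <;> simp only [hx, Finset.piecewise_eq_of_mem, not_false_eq_true,
    Finset.piecewise_eq_of_notMem] <;> exact fill_eq_fill fun _ => by simp [hx]

theorem eq_of_mem_support_consistentOracle {S : List (Word lam × Bool)} {F F' : Oracle lam}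
    (hF : F ∈ (consistentOracle S).support) (hF' : F' ∈ (consistentOracle S).support)
    {x : Word lam} (hx : x ∈ points S) : F x = F' x := by
  obtain ⟨G, -, rfl⟩ := (PMF.mem_support_map_iff _ _ _).1 hF
  obtain ⟨G', -, rfl⟩ := (PMF.mem_support_map_iff _ _ _).1 hF'
  exact fill_eq_fill fun h => absurd hx h

theorem mean_consistentOracle_piecewise (S : List (Word lam × Bool))
    {D : Oracle lam → Finset (Word lam)} (hD : ∀ F F', (∀ x ∈ D F, F' x = F x) → D F' = D F)
    (ψ : Oracle lam → ℝ≥0∞) :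
    (mean (consistentOracle S) fun F => mean (consistentOracle S) fun F' =>
      ψ ((D F).piecewise F F')) = mean (consistentOracle S) ψ := by
  simp only [mean_consistentOracle, ← fill_piecewise]
  exact mean_uniformOfFintype_piecewise (D := fun G => D (fill S G))
    (fun G G' h => hD _ _ fun x hx => fill_eq_fill fun _ => h x hx) fun G => ψ (fill S G)

end Tables

section Transcripts

variable {lam : ℕ}

/-- `R F` is a table of answers of the oracle `F` whose entries do not depend on the values of `F`
that it does not record; such is the record of any number of runs of deterministic algorithms. -/
structure IsTranscript (R : Oracle lam → List (Word lam × Bool)) : Prop where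
  eq_of_mem : ∀ {F x b}, (x, b) ∈ R F → b = F x
  congr : ∀ {F F'}, (∀ x ∈ points (R F), F' x = F x) → R F' = R F

namespace IsTranscript

variable {R : Oracle lam → List (Word lam × Bool)}

theorem fill_eq (hR : IsTranscript R) (F G : Oracle lam) :
    fill (R F) G = (points (R F)).piecewise F G := by
  ext1 x
  by_cases hx : x ∈ points (R F)
  · obtain ⟨b, hb, hfill⟩ := exists_fill_eq hx
    rw [hfill, Finset.piecewise_eq_of_mem _ _ _ hx, hR.eq_of_mem hb]
  · rw [fill_of_notMem hx, Finset.piecewise_eq_of_notMem _ _ _ hx]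

/-- Lazy sampling. -/
theorem mean_consistentOracle (hR : IsTranscript R)
    (ψ : List (Word lam × Bool) → Oracle lam → ℝ≥0∞) :
    (mean (PMF.uniformOfFintype (Oracle lam)) fun F =>
      mean (consistentOracle (R F)) fun G => ψ (R F) G) =
      mean (PMF.uniformOfFintype (Oracle lam)) fun F => ψ (R F) F := by
  rw [← mean_uniformOfFintype_piecewise (D := fun F => points (R F))
    (fun F F' h => by rw [hR.congr h]) fun F => ψ (R F) F]
  simp only [PRC.mean_consistentOracle, hR.fill_eq]
  refine mean_congr fun F _ => mean_congr fun G _ => ?_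
  have hcongr : R ((points (R F)).piecewise F G) = R F :=
    hR.congr fun x hx => Finset.piecewise_eq_of_mem _ _ _ hx
  rw [hcongr]

theorem flatten_ofFn {N : ℕ} {R : Fin N → Oracle lam → List (Word lam × Bool)}
    (hR : ∀ i, IsTranscript (R i)) : IsTranscript fun F => (List.ofFn fun i => R i F).flatten where
  eq_of_mem h := by
    simp only [List.mem_flatten, List.mem_ofFn] at h
    obtain ⟨_, ⟨i, rfl⟩, hi⟩ := h
    exact (hR i).eq_of_mem hi
  congr {F F'} h := by
    congr 2
    ext1 i
    refine (hR i).congr fun x hx => h x ?_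
    obtain ⟨b, hb⟩ := mem_points.1 hx
    exact mem_points.2 ⟨b, List.mem_flatten.2 ⟨_, List.mem_ofFn.2 ⟨i, rfl⟩, hb⟩⟩

end IsTranscript

namespace QueryTree

variable {α : Type}

/-- The points queried in the run with oracle `F`. -/
def queries (T : QueryTree lam α) (F : Oracle lam) : Finset (Word lam) :=
  points (T.transcript F)

theorem card_queries_le {T : QueryTree lam α} {Q : ℕ} (hT : T.QueriesAtMost Q) (F : Oracle lam) :
    (T.queries F).card ≤ Q :=
  (card_points_le _).trans (hT F)

theorem run_congr {T : QueryTree lam α} {F F' : Oracle lam} (h : ∀ x ∈ T.queries F, F' x = F x) :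
    T.transcript F' = T.transcript F ∧ T.eval F' = T.eval F := by
  induction T with
  | output a => exact ⟨rfl, rfl⟩
  | query y next ih =>
    simp only [queries, points, transcript, List.map_cons, List.toFinset_cons,
      Finset.forall_mem_insert] at h
    obtain ⟨htranscript, heval⟩ := ih (F y) h.2
    simp [transcript, eval, h.1, htranscript, heval]

theorem eval_congr {T : QueryTree lam α} {F F' : Oracle lam} (h : ∀ x ∈ T.queries F, F' x = F x) :
    T.eval F' = T.eval F :=
  (run_congr h).2

theorem isTranscript (T : QueryTree lam α) : IsTranscript fun F => T.transcript F where
  eq_of_mem {F x b} h := by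
    induction T with
    | output a => exact absurd h List.not_mem_nil
    | query y next ih =>
      rw [transcript, List.mem_cons, Prod.mk.injEq] at h
      rcases h with ⟨rfl, rfl⟩ | h
      exacts [rfl, ih _ h]
  congr h := (run_congr h).1

theorem queries_congr {T : QueryTree lam α} {F F' : Oracle lam}
    (h : ∀ x ∈ T.queries F, F' x = F x) : T.queries F' = T.queries F :=
  congrArg points (T.isTranscript.congr h)

theorem eval_piecewise_right {T : QueryTree lam α} {s : Finset (Word lam)} {F F' : Oracle lam}
    (h : ∀ x ∈ T.queries F', x ∈ s → F x = F' x) : T.eval (s.piecewise F F') = T.eval F' := by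
  refine eval_congr fun x hx => ?_
  by_cases hs : x ∈ s
  · rw [Finset.piecewise_eq_of_mem _ _ _ hs, h x hx hs]
  · rw [Finset.piecewise_eq_of_notMem _ _ _ hs]

theorem mean_eval_le_of_shared_oracle {β : Type} (S : List (Word lam × Bool))
    (T : QueryTree lam α) (κ : α → PMF (QueryTree lam β)) {g : β → ℝ≥0∞} (hg : ∀ b, g b ≤ 1) :
    (mean (consistentOracle S) fun F => mean (κ (T.eval F)) fun T' => g (T'.eval F)) ≤
      mean (consistentOracle S) fun F₁ => mean (consistentOracle S) fun F₂ =>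
        mean (κ (T.eval F₁)) fun T' => g (T'.eval F₂) +
          if ∃ x ∈ T.queries F₁ \ points S, x ∈ T'.queries F₂ then 1 else 0 := by
  rw [← mean_consistentOracle_piecewise S (D := T.queries) fun F F' => queries_congr]
  refine mean_mono fun F₁ hF₁ => mean_mono fun F₂ hF₂ => ?_
  rw [eval_congr fun x hx => Finset.piecewise_eq_of_mem _ F₁ F₂ hx]
  refine mean_mono fun T' _ => ?_
  split_ifs with hbad
  · exact le_add_left (hg _)
  · rw [add_zero, eval_piecewise_right fun x hx' hx =>
      eq_of_mem_support_consistentOracle hF₁ hF₂ ?_]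
    by_contra hxS
    exact hbad ⟨x, Finset.mem_sdiff.2 ⟨hx, hxS⟩, hx'⟩

end QueryTree

end Transcripts

/-! ### Keys that store a table -/

section Keys

variable {lam : ℕ}

theorem length_encodeSlot (o : Option (Word lam × Bool)) : (encodeSlot o).length = lam + 2 := by
  rcases o with _ | ⟨x, b⟩ <;> simp [encodeSlot]

theorem decodeSlot_encodeSlot (o : Option (Word lam × Bool)) :
    decodeSlot lam (encodeSlot o) = o := by
  rcases o with _ | ⟨x, b⟩
  · simp [decodeSlot, encodeSlot, List.replicate_succ]
  · simp [decodeSlot, encodeSlot]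

theorem length_flatMap_encodeSlot {ι : Type*} (l : List ι) (g : ι → Option (Word lam × Bool)) :
    (l.flatMap fun i => encodeSlot (g i)).length = l.length * (lam + 2) := by
  simp [List.length_flatMap, length_encodeSlot]

theorem length_encodeKey (N : ℕ) (sk : List Bool) (S : List (Word lam × Bool)) :
    (encodeKey N sk S).length = N * (lam + 2) + sk.length := by
  rw [encodeKey, List.length_append, length_flatMap_encodeSlot, List.length_range]

theorem take_drop_encodeKey {N i : ℕ} (hi : i < N) (sk : List Bool) (S : List (Word lam × Bool)) :
    ((encodeKey N sk S).drop (i * (lam + 2))).take (lam + 2) = encodeSlot S[i]? := by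
  obtain ⟨j, rfl⟩ := Nat.exists_eq_add_of_le (Nat.succ_le_of_lt hi)
  rw [encodeKey, List.range_add, List.range_succ, List.flatMap_append, List.flatMap_append,
    List.append_assoc, List.append_assoc, List.drop_left', List.flatMap_singleton,
    List.take_left' (length_encodeSlot _)]
  rw [length_flatMap_encodeSlot, List.length_range]

theorem filterMap_range_getElem? {β : Type*} (S : List β) {N : ℕ} (h : S.length ≤ N) :
    ((List.range N).filterMap fun i => S[i]?) = S := by
  induction S generalizing N with
  | nil => simp
  | cons a S ih =>
    obtain ⟨N, rfl⟩ := Nat.exists_eq_add_of_le' (Nat.zero_lt_of_lt h)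
    rw [List.range_succ_eq_map, List.filterMap_cons_some (b := a) (by simp), List.filterMap_map]
    exact congrArg _ (ih (Nat.le_of_succ_le_succ h))

theorem parseKey_encodeKey {N : ℕ} (sk : List Bool) {S : List (Word lam × Bool)}
    (h : S.length ≤ N) : parseKey lam N (encodeKey N sk S) = (sk, S) := by
  refine Prod.ext ?_ ?_
  · refine List.drop_left' ?_
    rw [length_flatMap_encodeSlot, List.length_range]
  · refine (List.filterMap_congr fun i hi => ?_).trans (filterMap_range_getElem? S h)
    rw [take_drop_encodeKey (List.mem_range.1 hi), decodeSlot_encodeSlot]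

end Keys

section Reencoding

variable {K K' : Type} {n : ℕ}

theorem bind_map_congr {α β γ : Type*} {p : PMF α} {g : α → β} {f : α → PMF γ} {f' : β → PMF γ}
    (h : ∀ a ∈ p.support, f' (g a) = f a) : (p.map g).bind f' = p.bind f := by
  refine eq_of_forall_mean_eq fun φ => ?_
  simp only [mean_bind, mean_map]
  exact mean_congr fun a ha => by rw [h a ha]

theorem Code.IsPRC.map_keys {P : Code K n} {ρ : unitInterval} {q : ℕ∞} {δ ε μ : ℝ}
    (hP : P.IsPRC ρ q δ ε μ) {P' : Code K' n} {g : K → K'} (hkeyGen : P'.keyGen = P.keyGen.map g)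
    (henc : ∀ k ∈ P.keyGen.support, P'.enc (g k) = P.enc k)
    (hdec : ∀ k ∈ P.keyGen.support, P'.dec (g k) = P.dec k) : P'.IsPRC ρ q δ ε μ where
  complete := by
    rw [Code.Complete, hkeyGen, bind_map_congr fun k hk => by rw [henc k hk, hdec k hk]]
    exact hP.complete
  pseudorandom m hm A := by
    rw [hkeyGen, bind_map_congr fun k hk => by rw [henc k hk]]
    exact hP.pseudorandom m hm A
  sound c := by
    rw [hkeyGen, bind_map_congr fun k hk => by rw [hdec k hk]]
    exact hP.sound c

end Reencoding

section Tabled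

variable {lam n : ℕ}

/-- The compiled scheme with unencoded keys `(sk, S)`, where the table `S` records `N` runs of the
decoder. -/
noncomputable def ROCode.tabled (P : ROCode lam n) (N : ℕ) :
    Code (List Bool × List (Word lam × Bool)) n where
  keyGen := P.keyGen.bind fun sk => (PMF.uniformOfFintype (Oracle lam)).bind fun F =>
    (decoderTable P N sk F).map fun S => (sk, S)
  enc k := (consistentOracle k.2).bind fun F => P.inROM.enc (k.1, F)
  dec k c := (consistentOracle k.2).bind fun F => P.inROM.dec (k.1, F) c

theorem mean_tabled_keyGen (P : ROCode lam n) (N : ℕ)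
    (f : List Bool × List (Word lam × Bool) → ℝ≥0∞) :
    mean (P.tabled N).keyGen f = mean P.keyGen fun sk =>
      mean (PMF.uniformOfFintype (Oracle lam)) fun F =>
        mean (decoderTable P N sk F) fun S => f (sk, S) := by
  simp only [ROCode.tabled, mean_bind, mean_map]

theorem decoderRun_eq_map (P : ROCode lam n) (sk : List Bool) (F : Oracle lam) :
    decoderRun P sk F =
      ((PMF.uniformOfFintype (Word n)).bind (P.dec sk)).map fun T => T.transcript F := by
  rw [decoderRun, PMF.map_bind]

theorem mean_decoderTable_consistentOracle (P : ROCode lam n) (N : ℕ) (sk : List Bool)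
    (ψ : List (Word lam × Bool) → Oracle lam → ℝ≥0∞) :
    (mean (PMF.uniformOfFintype (Oracle lam)) fun F => mean (decoderTable P N sk F) fun S =>
      mean (consistentOracle S) fun G => ψ S G) =
      mean (PMF.uniformOfFintype (Oracle lam)) fun F =>
        mean (decoderTable P N sk F) fun S => ψ S F := by
  simp only [decoderTable, decoderRun_eq_map, iid_map, mean_map]
  refine (mean_comm _ _ _).trans (Eq.trans (mean_congr fun v _ => ?_) (mean_comm _ _ _))
  exact (IsTranscript.flatten_ofFn fun i => (v i).isTranscript).mean_consistentOracle ψ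

theorem mean_tabled_keyGen_consistentOracle (P : ROCode lam n) (N : ℕ)
    (ψ : List Bool × List (Word lam × Bool) → Oracle lam → ℝ≥0∞) :
    (mean (P.tabled N).keyGen fun k => mean (consistentOracle k.2) fun F => ψ k F) =
      mean P.keyGen fun sk => mean (PMF.uniformOfFintype (Oracle lam)) fun F =>
        mean (decoderTable P N sk F) fun S => ψ (sk, S) F := by
  rw [mean_tabled_keyGen]
  exact mean_congr fun sk _ => mean_decoderTable_consistentOracle P N sk fun S => ψ (sk, S)

theorem tabled_keyGen_bind_consistentOracle {β : Type*} (P : ROCode lam n) (N : ℕ)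
    (h : List Bool × Oracle lam → PMF β) :
    ((P.tabled N).keyGen.bind fun k => (consistentOracle k.2).bind fun F => h (k.1, F)) =
      P.inROM.keyGen.bind h := by
  refine eq_of_forall_mean_eq fun φ => ?_
  simp only [mean_bind]
  rw [mean_tabled_keyGen_consistentOracle P N fun k F => mean (h (k.1, F)) φ]
  simp only [ROCode.inROM, mean_bind, mean_map, mean_const]

theorem length_le_of_mem_support_decoderTable {P : ROCode lam n} {Q N : ℕ} (hP : P.QueriesAtMost Q)
    {sk : List Bool} (hsk : sk ∈ P.keyGen.support) {F : Oracle lam} {S : List (Word lam × Bool)}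
    (hS : S ∈ (decoderTable P N sk F).support) : S.length ≤ Q * N := by
  obtain ⟨v, hv, rfl⟩ := (PMF.mem_support_map_iff _ _ _).1 hS
  have hlength : ∀ i, (v i).length ≤ Q := fun i => by
    have hrun := mem_support_of_mem_support_iid _ hv i
    simp only [decoderRun, PMF.mem_support_bind_iff, PMF.mem_support_map_iff] at hrun
    obtain ⟨x, -, T, hT, htranscript⟩ := hrun
    exact htranscript ▸ (hP sk hsk).2 x T hT F
  rw [List.length_flatten, List.map_ofFn, List.sum_ofFn]
  exact (Finset.sum_le_card_nsmul _ _ Q fun i _ => hlength i).trans_eq (by simp [mul_comm])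

theorem mem_support_tabled_keyGen {P : ROCode lam n} {Q N : ℕ} (hP : P.QueriesAtMost Q)
    {k : List Bool × List (Word lam × Bool)} (hk : k ∈ (P.tabled N).keyGen.support) :
    k.1 ∈ P.keyGen.support ∧ k.2.length ≤ Q * N := by
  simp only [ROCode.tabled, PMF.mem_support_bind_iff, PMF.mem_support_map_iff] at hk
  obtain ⟨sk, hsk, F, -, S, hS, rfl⟩ := hk
  exact ⟨hsk, length_le_of_mem_support_decoderTable hP hsk hS⟩

end Tabled

section Compile

variable {lam n : ℕ} (P : ROCode lam n) (Q : ℕ) (τ : ℝ)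

theorem compile_keyGen :
    (compile P Q τ).keyGen = (P.tabled ⌈lam / τ⌉₊).keyGen.map fun k =>
      encodeKey (Q * ⌈lam / τ⌉₊) k.1 k.2 := by
  simp only [compile, ROCode.tabled, PMF.map_bind, PMF.map_comp, Function.comp_def]

theorem compile_enc (k : List Bool) :
    (compile P Q τ).enc k =
      (P.tabled ⌈lam / τ⌉₊).enc (parseKey lam (Q * ⌈lam / τ⌉₊) k) := rfl

theorem compile_dec (k : List Bool) :
    (compile P Q τ).dec k =
      (P.tabled ⌈lam / τ⌉₊).dec (parseKey lam (Q * ⌈lam / τ⌉₊) k) := rfl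

variable {P Q}

theorem parseKey_encodeKey_of_mem_support (hP : P.QueriesAtMost Q) {N : ℕ}
    {k : List Bool × List (Word lam × Bool)} (hk : k ∈ (P.tabled N).keyGen.support) :
    parseKey lam (Q * N) (encodeKey (Q * N) k.1 k.2) = k :=
  parseKey_encodeKey k.1 (mem_support_tabled_keyGen hP hk).2

theorem length_le_of_mem_support_compile_keyGen {ℓ : ℕ}
    (hℓ : ∀ sk ∈ P.keyGen.support, sk.length ≤ ℓ) (hP : P.QueriesAtMost Q) {τ : ℝ} {k : List Bool}
    (hk : k ∈ (compile P Q τ).keyGen.support) :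
    k.length ≤ ℓ + Q * ⌈lam / τ⌉₊ * (lam + 2) := by
  rw [compile_keyGen, PMF.mem_support_map_iff] at hk
  obtain ⟨k', hk', rfl⟩ := hk
  rw [length_encodeKey, add_comm]
  gcongr
  exact hℓ _ (mem_support_tabled_keyGen hP hk').1

end Compile

theorem mul_ceil_div_mul_le {lam Q : ℕ} (hlam : 1 ≤ lam) {τ : ℝ} (hτ0 : 0 < τ) (hτ1 : τ ≤ 1) :
    ((Q * ⌈lam / τ⌉₊ * (lam + 2) : ℕ) : ℝ) ≤ 6 * (Q * (lam : ℝ) ^ 2 / τ) := by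
  have hlam' : (1 : ℝ) ≤ lam := by exact_mod_cast hlam
  have hquot : 1 ≤ lam / τ := (one_le_div hτ0).2 (hτ1.trans hlam')
  push_cast
  calc (Q : ℝ) * ⌈(lam : ℝ) / τ⌉₊ * (lam + 2) ≤ Q * (2 * (lam / τ)) * (3 * lam) := by
        gcongr
        · linarith [Nat.ceil_lt_add_one (zero_le_one.trans hquot)]
        · linarith
    _ = _ := by ring

/-! ### Heavy queries -/

section Heavy

variable {lam n : ℕ} {P : ROCode lam n} {Q : ℕ} {τ : ℝ} {sk : List Bool}

/-- The set of points that the decoder queries on a uniformly random word. -/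
noncomputable def decoderQueries (P : ROCode lam n) (sk : List Bool) (F : Oracle lam) :
    PMF (Finset (Word lam)) :=
  (decoderRun P sk F).map points

theorem decoderQueries_eq_bind (P : ROCode lam n) (sk : List Bool) (F : Oracle lam) :
    decoderQueries P sk F = (PMF.uniformOfFintype (Word n)).bind fun x =>
      (P.dec sk x).map fun T => T.queries F := by
  simp only [decoderQueries, decoderRun, PMF.map_bind, PMF.map_comp]
  rfl

theorem card_le_of_mem_support_decoderQueries (hP : P.QueriesAtMost Q)
    (hsk : sk ∈ P.keyGen.support) {F : Oracle lam} {s : Finset (Word lam)}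
    (hs : s ∈ (decoderQueries P sk F).support) : s.card ≤ Q := by
  simp only [decoderQueries_eq_bind, PMF.mem_support_bind_iff, PMF.mem_support_map_iff] at hs
  obtain ⟨x, -, T, hT, rfl⟩ := hs
  exact T.card_queries_le ((hP sk hsk).2 x T hT) F

theorem heavy_iff {F : Oracle lam} {x : Word lam} :
    Heavy P τ sk F x ↔ τ ≤ (hitProb (decoderQueries P sk F) x).toReal := by
  rw [Heavy, prob, map_apply_true_eq_mean, hitProb, decoderQueries, mean_map]
  simp only [mem_points]
  congr!

/-- The table `S` misses a `τ`-heavy query for the key `sk` and the oracle `F`. -/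
def Misses (P : ROCode lam n) (τ : ℝ) (sk : List Bool) (F : Oracle lam)
    (S : List (Word lam × Bool)) : Prop :=
  ∃ x, Heavy P τ sk F x ∧ ∀ b, (x, b) ∉ S

open scoped Classical in
theorem mean_decoderTable_misses_le (hP : P.QueriesAtMost Q) (hτ : 0 < τ)
    (hsk : sk ∈ P.keyGen.support) (F : Oracle lam) :
    (mean (decoderTable P ⌈lam / τ⌉₊ sk F) fun S => if Misses P τ sk F S then 1 else 0) ≤
      ENNReal.ofReal ((2⁻¹ : ℝ) ^ lam * Q / τ) := by
  refine le_trans (le_of_eq ?_) (mean_iid_exists_notMem_le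
    (fun s => card_le_of_mem_support_decoderQueries hP hsk (F := F)) hτ lam)
  rw [decoderTable, mean_map, decoderQueries, iid_map, mean_map]
  refine mean_congr fun v _ => ?_
  have hnotMem : ∀ x, (∀ b, (x, b) ∉ (List.ofFn v).flatten) ↔ ∀ i, x ∉ points (v i) := fun x => by
    simp only [mem_points, not_exists, List.mem_flatten, List.mem_ofFn]
    grind
  simp only [Misses, heavy_iff, hnotMem, decoderQueries]

open scoped Classical in
theorem mean_keyGen_misses_le (hP : P.QueriesAtMost Q) (hτ : 0 < τ) :
    (mean P.keyGen fun sk => mean (PMF.uniformOfFintype (Oracle lam)) fun F =>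
      mean (decoderTable P ⌈lam / τ⌉₊ sk F) fun S => if Misses P τ sk F S then 1 else 0) ≤
      ENNReal.ofReal ((2⁻¹ : ℝ) ^ lam * Q / τ) :=
  mean_le_of_forall_le fun _ hsk => mean_le_of_forall_le fun F _ =>
    mean_decoderTable_misses_le hP hτ hsk F

theorem missProbability_le (hP : P.QueriesAtMost Q) (hτ : 0 < τ) :
    missProbability P τ ≤ (2⁻¹ : ℝ) ^ lam * Q / τ := by
  classical
  refine ENNReal.toReal_le_of_le_ofReal (by positivity)
    (le_trans (le_of_eq ?_) (mean_keyGen_misses_le hP hτ))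
  rw [apply_eq_mean]
  simp only [mean_bind, mean_map, eq_iff_iff, iff_true]
  rfl

end Heavy

/-! ### Completeness -/

section Collision

variable {lam n : ℕ}

/-- A codeword, and the queries outside the table `S` that the encoder makes to produce it. -/
noncomputable def encoderQueries (P : ROCode lam n) (sk : List Bool)
    (S : List (Word lam × Bool)) : PMF (Word n × Finset (Word lam)) :=
  (consistentOracle S).bind fun F =>
    (P.enc sk).map fun T => (T.eval F, T.queries F \ points S)

/-- The queries outside the table `S` that the decoder makes on `x`.  They are discarded if `S`
misses a heavy query, so that all of them are light. -/
noncomputable def lightQueries (P : ROCode lam n) (τ : ℝ) (sk : List Bool)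
    (S : List (Word lam × Bool)) (x : Word n) : PMF (Finset (Word lam)) :=
  open scoped Classical in
  (consistentOracle S).bind fun F =>
    (P.dec sk x).map fun T => if Misses P τ sk F S then ∅ else T.queries F \ points S

variable {P : ROCode lam n} {Q : ℕ} {τ : ℝ} {sk : List Bool}

theorem map_fst_encoderQueries (P : ROCode lam n) (N : ℕ) (sk : List Bool)
    (S : List (Word lam × Bool)) :
    (encoderQueries P sk S).map Prod.fst = (P.tabled N).enc (sk, S) := by
  simp only [encoderQueries, PMF.map_bind, PMF.map_comp]
  rfl

theorem card_le_of_mem_support_encoderQueries (hP : P.QueriesAtMost Q)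
    (hsk : sk ∈ P.keyGen.support) {S : List (Word lam × Bool)} {z : Word n × Finset (Word lam)}
    (hz : z ∈ (encoderQueries P sk S).support) : z.2.card ≤ Q := by
  simp only [encoderQueries, PMF.mem_support_bind_iff, PMF.mem_support_map_iff] at hz
  obtain ⟨F, -, T, hT, rfl⟩ := hz
  exact (Finset.card_le_card Finset.sdiff_subset).trans
    (T.card_queries_le ((hP sk hsk).1 T hT) F)

theorem card_le_of_mem_support_lightQueries (hP : P.QueriesAtMost Q)
    (hsk : sk ∈ P.keyGen.support) {S : List (Word lam × Bool)} {x : Word n}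
    {s : Finset (Word lam)} (hs : s ∈ (lightQueries P τ sk S x).support) : s.card ≤ Q := by
  simp only [lightQueries, PMF.mem_support_bind_iff, PMF.mem_support_map_iff] at hs
  obtain ⟨F, -, T, hT, rfl⟩ := hs
  split_ifs
  · exact Nat.zero_le _
  · exact (Finset.card_le_card Finset.sdiff_subset).trans
      (T.card_queries_le ((hP sk hsk).2 x T hT) F)

theorem hitProb_lightQueries_le (hτ : 0 ≤ τ) (S : List (Word lam × Bool)) (y : Word lam) :
    hitProb ((PMF.uniformOfFintype (Word n)).bind (lightQueries P τ sk S)) y ≤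
      ENNReal.ofReal τ := by
  simp only [hitProb, lightQueries, mean_bind, mean_map]
  rw [mean_comm]
  refine mean_le_of_forall_le fun F _ => ?_
  by_cases hlight : Misses P τ sk F S ∨ y ∈ points S
  · refine le_trans (le_of_eq ?_) zero_le
    rcases hlight with hmiss | hy
    · simp only [hmiss, if_true, Finset.notMem_empty, if_false, mean_const]
    · simp only [apply_ite (y ∈ ·), Finset.mem_sdiff, hy, not_true, and_false,
        Finset.notMem_empty, if_false, mean_const, ite_self]
  · push Not at hlight
    have hy : ¬ Heavy P τ sk F y := fun hy =>
      hlight.1 ⟨y, hy, fun b hb => hlight.2 (mem_points.2 ⟨b, hb⟩)⟩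
    rw [heavy_iff, not_le, decoderQueries_eq_bind] at hy
    refine le_trans (le_of_eq ?_)
      ((ENNReal.le_ofReal_iff_toReal_le (hitProb_ne_top _ y) hτ).2 hy.le)
    simp only [hitProb, mean_bind, mean_map, hlight.1, if_false, Finset.mem_sdiff, hlight.2,
      not_false_eq_true, and_true]

open scoped Classical in
theorem mean_collision_le_misses_add (hP : P.QueriesAtMost Q) (ρ : unitInterval) (hτ : 0 ≤ τ)
    (hsk : sk ∈ P.keyGen.support) (N : ℕ) (S : List (Word lam × Bool)) :
    (mean (consistentOracle S) fun F₁ => mean (P.enc sk) fun T =>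
      mean (noise ρ (T.eval F₁)) fun x => mean (consistentOracle S) fun F₂ =>
        mean (P.dec sk x) fun T' =>
          if ∃ y ∈ T.queries F₁ \ points S, y ∈ T'.queries F₂ then 1 else 0) ≤
      (mean (consistentOracle S) fun F => if Misses P τ sk F S then 1 else 0) +
        ENNReal.ofReal (Q * τ ^ ((1 / 2 : ℝ) * ((1 - (ρ : ℝ) ^ 2) / (1 + (ρ : ℝ) ^ 2))) +
          Q * tvUniform ((P.tabled N).enc (sk, S))) := by
  have hlight := mean_collision_le ρ (E := encoderQueries P sk S)
    (fun z => card_le_of_mem_support_encoderQueries hP hsk)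
    (fun x s => card_le_of_mem_support_lightQueries (S := S) hP hsk) hτ
    (hitProb_lightQueries_le hτ S)
  rw [map_fst_encoderQueries P N] at hlight
  refine le_trans ?_ (add_le_add_right hlight _)
  simp only [encoderQueries, lightQueries, mean_bind, mean_map]
  calc _ ≤ mean (consistentOracle S) fun F₁ => mean (P.enc sk) fun T =>
        mean (noise ρ (T.eval F₁)) fun x => mean (consistentOracle S) fun F₂ =>
          mean (P.dec sk x) fun T' => (if Misses P τ sk F₂ S then 1 else 0) +
            if ∃ y ∈ T.queries F₁ \ points S,
              y ∈ if Misses P τ sk F₂ S then ∅ else T'.queries F₂ \ points S then 1 else 0 := by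
        refine mean_mono fun F₁ _ => mean_mono fun T _ => mean_mono fun x _ =>
          mean_mono fun F₂ _ => mean_mono fun T' _ => ?_
        by_cases hmiss : Misses P τ sk F₂ S
        · rw [if_pos hmiss]
          exact le_add_right (ite_le_one _)
        · simp only [hmiss, if_false, zero_add]
          split_ifs with hcoll hlight
          · exact le_rfl
          · exact absurd hcoll (by grind)
          · exact zero_le
          · exact le_rfl
    _ = _ := by simp only [mean_add, mean_const]

end Collision

section Acceptance

variable {lam n : ℕ}

/-- The probability that the decoder accepts a noisy codeword. -/
noncomputable def Code.acceptance {K : Type} (P : Code K n) (ρ : unitInterval) : ℝ≥0∞ :=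
  (P.keyGen.bind fun k => (P.enc k).bind fun c => (noise ρ c).bind fun x => P.dec k x) true

theorem acceptance_inROM_eq (P : ROCode lam n) (N : ℕ) (ρ : unitInterval) :
    P.inROM.acceptance ρ = mean (P.tabled N).keyGen fun k => mean (consistentOracle k.2) fun F =>
      mean (P.enc k.1) fun T => mean ((noise ρ (T.eval F)).bind (P.dec k.1)) fun T' =>
        if T'.eval F then 1 else 0 := by
  rw [Code.acceptance, ← tabled_keyGen_bind_consistentOracle P N, apply_true_eq_mean]
  simp only [mean_bind, ROCode.inROM, mean_map]

theorem acceptance_tabled_eq (P : ROCode lam n) (N : ℕ) (ρ : unitInterval) :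
    (P.tabled N).acceptance ρ = mean (P.tabled N).keyGen fun k =>
      mean (consistentOracle k.2) fun F₁ => mean (P.enc k.1) fun T =>
        mean (noise ρ (T.eval F₁)) fun x => mean (consistentOracle k.2) fun F₂ =>
          mean (P.dec k.1 x) fun T' => if T'.eval F₂ then 1 else 0 := by
  rw [Code.acceptance, apply_true_eq_mean, mean_bind]
  simp only [mean_bind, ROCode.tabled, ROCode.inROM, mean_map]

theorem mean_shared_oracle_le (P : ROCode lam n) (ρ : unitInterval) (sk : List Bool)
    (S : List (Word lam × Bool)) :
    (mean (consistentOracle S) fun F => mean (P.enc sk) fun T =>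
      mean ((noise ρ (T.eval F)).bind (P.dec sk)) fun T' => if T'.eval F then 1 else 0) ≤
      (mean (consistentOracle S) fun F₁ => mean (P.enc sk) fun T =>
        mean (noise ρ (T.eval F₁)) fun x => mean (consistentOracle S) fun F₂ =>
          mean (P.dec sk x) fun T' => if T'.eval F₂ then 1 else 0) +
      mean (consistentOracle S) fun F₁ => mean (P.enc sk) fun T =>
        mean (noise ρ (T.eval F₁)) fun x => mean (consistentOracle S) fun F₂ =>
          mean (P.dec sk x) fun T' =>
            if ∃ y ∈ T.queries F₁ \ points S, y ∈ T'.queries F₂ then 1 else 0 := by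
  simp only [← mean_add]
  rw [mean_comm, mean_comm (consistentOracle S) (P.enc sk)]
  refine mean_mono fun T _ => ?_
  refine (T.mean_eval_le_of_shared_oracle S (fun c => (noise ρ c).bind (P.dec sk))
    (g := fun b => if b then 1 else 0) fun b => ite_le_one _).trans_eq ?_
  simp only [mean_bind]
  exact mean_congr fun F₁ _ => mean_comm _ _ _

theorem acceptance_inROM_le {P : ROCode lam n} {Q : ℕ} (hP : P.QueriesAtMost Q)
    (ρ : unitInterval) {τ : ℝ} (hτ : 0 < τ) :
    P.inROM.acceptance ρ ≤ (P.tabled ⌈lam / τ⌉₊).acceptance ρ +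
      (ENNReal.ofReal ((2⁻¹ : ℝ) ^ lam * Q / τ) +
        (ENNReal.ofReal (Q * τ ^ ((1 / 2 : ℝ) * ((1 - (ρ : ℝ) ^ 2) / (1 + (ρ : ℝ) ^ 2)))) +
          Q * mean (P.tabled ⌈lam / τ⌉₊).keyGen fun k =>
            ENNReal.ofReal (tvUniform ((P.tabled ⌈lam / τ⌉₊).enc k)))) := by
  classical
  have hmiss := mean_keyGen_misses_le hP hτ
  rw [← mean_tabled_keyGen_consistentOracle P _ fun k F =>
    if Misses P τ k.1 F k.2 then 1 else 0] at hmiss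
  rw [acceptance_inROM_eq P ⌈lam / τ⌉₊, acceptance_tabled_eq]
  refine le_trans ?_ (add_le_add_right (add_le_add_left hmiss _) _)
  rw [← mean_const_mul, ← mean_const (P.tabled ⌈lam / τ⌉₊).keyGen (ENNReal.ofReal (Q * τ ^ _)),
    ← mean_add, ← mean_add, ← mean_add]
  refine mean_mono fun k hk => (mean_shared_oracle_le P ρ k.1 k.2).trans ?_
  gcongr
  refine (mean_collision_le_misses_add hP ρ hτ.le (mem_support_tabled_keyGen hP hk).1
    ⌈lam / τ⌉₊ k.2).trans_eq ?_
  rw [ENNReal.ofReal_add (by positivity) (mul_nonneg (Nat.cast_nonneg _) (tvUniform_nonneg _)),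
    ENNReal.ofReal_mul (Nat.cast_nonneg Q) (q := tvUniform _), ENNReal.ofReal_natCast]

end Acceptance

/-! ### Pseudorandomness and short keys -/

section Average

variable {K : Type} {lam n : ℕ}

theorem Code.Pseudorandom.nonneg {P : Code K n} {q : ℕ∞} {ε : ℝ} (h : P.Pseudorandom q ε) :
    0 ≤ ε :=
  (abs_nonneg _).trans (h 0 zero_le fun _ => PMF.pure true)

/-- The distinguisher accepts the words that are at least as likely under the code as under the
uniform distribution. -/
theorem Code.Pseudorandom.tvUniform_le {P : Code K n} {q : ℕ∞} {ε : ℝ}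
    (h : P.Pseudorandom q ε) {m : ℕ} (hm : (m : ℕ∞) ≤ q) :
    tvUniform (P.keyGen.bind fun k => iid (P.enc k) m) ≤ ε := by
  classical
  set p := P.keyGen.bind fun k => iid (P.enc k) m with hp
  set u : ℝ := (Fintype.card (Fin m → Word n) : ℝ)⁻¹
  set A : (Fin m → Word n) → PMF Bool := fun c => PMF.pure (decide (u ≤ (p c).toReal)) with hA
  have hprob (r : PMF (Fin m → Word n)) :
      prob (r.bind A) true = ∑ c, (r c).toReal * if u ≤ (p c).toReal then 1 else 0 := by
    rw [prob, apply_true_eq_mean, mean_bind, mean_eq_sum, ENNReal.toReal_sum fun c _ =>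
      ENNReal.mul_ne_top (r.apply_ne_top c) (by simp only [hA, mean_pure]; split_ifs <;> simp)]
    simp only [hA, mean_pure, decide_eq_true_eq, ENNReal.toReal_mul]
    congr! 2
    split_ifs <;> simp
  have hunif (c : Fin m → Word n) : (PMF.uniformOfFintype (Fin m → Word n) c).toReal = u := by
    rw [PMF.uniformOfFintype_apply, ENNReal.toReal_inv, ENNReal.toReal_natCast]
  have hadv := (le_abs_self _).trans (h m hm A)
  rw [← PMF.bind_bind, ← hp, iid_uniformOfFintype, hprob, hprob,
    ← Finset.sum_sub_distrib] at hadv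
  refine le_trans (le_of_eq (Finset.sum_congr rfl fun c _ => ?_)) hadv
  rw [hunif]
  split_ifs with hc
  · rw [max_eq_left (sub_nonneg.2 hc), mul_one, mul_one]
  · rw [max_eq_right (sub_nonpos.2 (not_le.1 hc).le), mul_zero, mul_zero, sub_zero]

/-- The bit strings of length at most `L`, as a finite set. -/
def shortStrings (L : ℕ) : Finset (List Bool) :=
  (Finset.range (L + 1)).biUnion fun i => Finset.univ.image fun x : Word i => List.ofFn x

theorem mem_shortStrings {L : ℕ} {k : List Bool} (hk : k.length ≤ L) : k ∈ shortStrings L := by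
  simp only [shortStrings, Finset.mem_biUnion, Finset.mem_range, Finset.mem_image,
    Finset.mem_univ, true_and]
  exact ⟨k.length, Nat.lt_succ_of_le hk, k.get, List.ofFn_get k⟩

theorem card_shortStrings_le (L : ℕ) : (shortStrings L).card ≤ 2 ^ (L + 1) := by
  refine Finset.card_biUnion_le.trans ((Finset.sum_le_sum fun i _ =>
    Finset.card_image_le (s := Finset.univ) (f := fun x : Word i => List.ofFn x)).trans ?_)
  simp only [Finset.card_univ, Fintype.card_fun, Fintype.card_bool, Fintype.card_fin]
  exact (Nat.geomSum_lt le_rfl (by simp)).le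

theorem log_two_le_one : Real.log 2 ≤ 1 := by
  linarith [Real.log_le_sub_one_of_pos two_pos]

theorem log_card_shortStrings_le (L : ℕ) : Real.log (shortStrings L).card ≤ L + 1 :=
  calc Real.log (shortStrings L).card ≤ Real.log (2 ^ (L + 1)) :=
        Real.log_le_log
          (by exact_mod_cast Finset.card_pos.2 ⟨[], mem_shortStrings (Nat.zero_le L)⟩)
          (by exact_mod_cast card_shortStrings_le L)
    _ = (L + 1) * Real.log 2 := by rw [Real.log_pow, Nat.cast_succ]
    _ ≤ L + 1 := mul_le_of_le_one_right (by positivity) log_two_le_one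

/-- For a pseudorandom code the words `W k` may be several codewords under the key `k`: their
entropy is nearly full, while the key explains at most its length of it. -/
theorem mean_tvUniform_le_of_length_le {P : StdCode n} {L : ℕ}
    (hL : ∀ k ∈ P.keyGen.support, k.length ≤ L) {m : ℕ} (hm : 0 < m)
    {W : List Bool → PMF (Fin m → Word n)} (hW : ∀ k i, (W k).map (fun c => c i) = P.enc k)
    {η : ℝ} (hη : tvUniform (P.keyGen.bind W) ≤ η) :
    (mean P.keyGen fun k => ENNReal.ofReal (tvUniform (P.enc k))) ≤
      ENNReal.ofReal √((L + 1 + η * (m * n + 1)) / m) := by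
  have : Nonempty (Fin m) := Fin.pos_iff_nonempty.1 hm
  have hs : P.keyGen.support ⊆ shortStrings L := fun k hk => mem_shortStrings (hL k hk)
  have hword : Fintype.card (Fin m) * Real.log (Fintype.card (Word n)) ≤ m * n := by
    rw [Fintype.card_fun, Fintype.card_bool, Fintype.card_fin, Fintype.card_fin, Nat.cast_pow,
      Real.log_pow]
    exact mul_le_mul_of_nonneg_left (mul_le_of_le_one_right (by positivity) log_two_le_one)
      (by positivity)
  have hη0 : 0 ≤ η := (tvUniform_nonneg _).trans hη
  rw [mean_eq_sum_of_support_subset P.keyGen hs]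
  calc (∑ k ∈ shortStrings L, P.keyGen k * ENNReal.ofReal (tvUniform (P.enc k)))
      = ENNReal.ofReal (∑ k ∈ shortStrings L, (P.keyGen k).toReal * tvUniform (P.enc k)) := by
        rw [ENNReal.ofReal_sum_of_nonneg fun k _ =>
          mul_nonneg ENNReal.toReal_nonneg (tvUniform_nonneg _)]
        refine Finset.sum_congr rfl fun k _ => ?_
        rw [ENNReal.ofReal_mul ENNReal.toReal_nonneg,
          ENNReal.ofReal_toReal (P.keyGen.apply_ne_top k)]
    _ ≤ _ := by
        refine ENNReal.ofReal_le_ofReal (Real.le_sqrt_of_sq_le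
          ((sq_sum_mul_tvUniform_le P.keyGen hs hW).trans ?_))
        rw [Fintype.card_fin] at hword ⊢
        gcongr
        exact log_card_shortStrings_le L

variable {P : ROCode lam n} {Q : ℕ} {τ : ℝ}

theorem mean_compile_keyGen (hP : P.QueriesAtMost Q)
    (f : List Bool × List (Word lam × Bool) → ℝ≥0∞) :
    (mean (compile P Q τ).keyGen fun k => f (parseKey lam (Q * ⌈lam / τ⌉₊) k)) =
      mean (P.tabled ⌈lam / τ⌉₊).keyGen f := by
  rw [compile_keyGen, mean_map]
  exact mean_congr fun k hk => by rw [parseKey_encodeKey_of_mem_support hP hk]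

theorem mean_tabled_tvUniform_le (hP : P.QueriesAtMost Q) {q : ℕ∞} {ε : ℝ}
    (h : P.inROM.Pseudorandom q ε) {L : ℕ}
    (hL : ∀ k ∈ (compile P Q τ).keyGen.support, k.length ≤ L) {m : ℕ} (hm0 : 0 < m)
    (hm : (m : ℕ∞) ≤ q) :
    (mean (P.tabled ⌈lam / τ⌉₊).keyGen fun k =>
      ENNReal.ofReal (tvUniform ((P.tabled ⌈lam / τ⌉₊).enc k))) ≤
      ENNReal.ofReal √((L + 1 + ε * (m * n + 1)) / m) := by
  -- The samples share one oracle, so that averaged over the key they are codewords of `P.inROM`.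
  let W (k : List Bool × List (Word lam × Bool)) : PMF (Fin m → Word n) :=
    (consistentOracle k.2).bind fun F => iid (P.inROM.enc (k.1, F)) m
  have hlaw : ((compile P Q τ).keyGen.bind fun k => W (parseKey lam (Q * ⌈lam / τ⌉₊) k)) =
      P.inROM.keyGen.bind fun k => iid (P.inROM.enc k) m := by
    rw [compile_keyGen, bind_map_congr fun k hk => by
      rw [parseKey_encodeKey_of_mem_support hP hk]]
    exact tabled_keyGen_bind_consistentOracle P _ fun k => iid (P.inROM.enc k) m
  rw [← mean_compile_keyGen hP]
  refine mean_tvUniform_le_of_length_le hL hm0 (P := compile P Q τ)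
    (W := fun k => W (parseKey lam (Q * ⌈lam / τ⌉₊) k)) (fun k i => ?_)
    (hlaw ▸ h.tvUniform_le hm)
  simp only [W, PMF.map_bind, iid_map_apply]
  rfl

theorem mean_tabled_tvUniform_le_of_top (hP : P.QueriesAtMost Q) {ε : ℝ}
    (h : P.inROM.Pseudorandom ⊤ ε) {L : ℕ}
    (hL : ∀ k ∈ (compile P Q τ).keyGen.support, k.length ≤ L) :
    (mean (P.tabled ⌈lam / τ⌉₊).keyGen fun k =>
      ENNReal.ofReal (tvUniform ((P.tabled ⌈lam / τ⌉₊).enc k))) ≤ ENNReal.ofReal √(ε * n) := by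
  have hlim : Filter.Tendsto (fun m : ℕ =>
      ENNReal.ofReal √((L + 1 + ε) * (1 / ((m : ℝ) + 1)) + ε * n)) Filter.atTop
      (nhds (ENNReal.ofReal √((L + 1 + ε) * 0 + ε * n))) :=
    ENNReal.tendsto_ofReal
      ((tendsto_one_div_add_atTop_nhds_zero_nat.const_mul _).add_const _).sqrt
  rw [mul_zero, zero_add] at hlim
  refine ge_of_tendsto' hlim fun m =>
    (mean_tabled_tvUniform_le hP h hL m.succ_pos le_top).trans_eq ?_
  congr 2
  push_cast
  field_simp
  ring

theorem mean_tabled_tvUniform_le_sqrt (hlam : 1 ≤ lam) (hQ : 1 ≤ Q) (hP : P.QueriesAtMost Q)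
    (hτ0 : 0 < τ) (hτ1 : τ ≤ 1) {q : ℕ∞} {ε : ℝ} (h : P.inROM.Pseudorandom q ε) {ℓ : ℕ}
    (hℓ : ∀ sk ∈ P.keyGen.support, sk.length ≤ ℓ)
    (hq : q = ⊤ ∨ ∃ m : ℕ, (m : ℕ∞) ≤ q ∧ (ℓ : ℝ) + Q * (lam : ℝ) ^ 2 / τ ≤ m * (ε * n)) :
    (mean (P.tabled ⌈lam / τ⌉₊).keyGen fun k =>
      ENNReal.ofReal (tvUniform ((P.tabled ⌈lam / τ⌉₊).enc k))) ≤
      ENNReal.ofReal (3 * √(ε * n)) := by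
  have hL : ∀ k ∈ (compile P Q τ).keyGen.support,
      k.length ≤ ℓ + Q * ⌈lam / τ⌉₊ * (lam + 2) := fun k hk =>
    length_le_of_mem_support_compile_keyGen hℓ hP hk
  rcases hq with rfl | ⟨m, hmq, hm⟩
  · exact (mean_tabled_tvUniform_le_of_top hP h hL).trans
      (ENNReal.ofReal_le_ofReal (by linarith [Real.sqrt_nonneg (ε * n)]))
  have hone : 1 ≤ (Q : ℝ) * (lam : ℝ) ^ 2 / τ := by
    have hQ' : (1 : ℝ) ≤ Q := by exact_mod_cast hQ
    have hlam' : (1 : ℝ) ≤ lam := by exact_mod_cast hlam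
    rw [le_div_iff₀ hτ0]
    nlinarith [one_le_pow₀ hlam' (n := 2)]
  have hX : 1 ≤ (m : ℝ) * (ε * n) := by linarith [(Nat.cast_nonneg ℓ : (0 : ℝ) ≤ ℓ)]
  have hm0 : 0 < m := Nat.pos_of_ne_zero fun h0 => by norm_num [h0] at hX
  have hn0 : 0 < n := Nat.pos_of_ne_zero fun h0 => by norm_num [h0] at hX
  have hmn : 1 ≤ (m : ℝ) * n := by exact_mod_cast Nat.mul_pos hm0 hn0
  have hkey : ((ℓ + Q * ⌈lam / τ⌉₊ * (lam + 2) : ℕ) : ℝ) ≤ 6 * (m * (ε * n)) := by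
    rw [Nat.cast_add]
    linarith [mul_ceil_div_mul_le (Q := Q) hlam hτ0 hτ1, (Nat.cast_nonneg ℓ : (0 : ℝ) ≤ ℓ)]
  refine (mean_tabled_tvUniform_le hP h hL hm0 hmq).trans (ENNReal.ofReal_le_ofReal ?_)
  have hε := h.nonneg
  rw [Real.sqrt_le_left (by positivity), mul_pow, Real.sq_sqrt (by positivity),
    div_le_iff₀ (by positivity)]
  linarith [mul_le_mul_of_nonneg_left hmn hε]

end Average

/-! ### The compiled scheme is a pseudorandom code -/

section MultiUse

variable {K : Type} {n : ℕ}

/-- The code `P` with an encoder for adversaries that see many codewords, for a scheme with at most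
`Q` oracle queries.  Fresh oracles for each codeword could spoil pseudorandomness, so codewords are
uniformly random, which affects completeness only by their distance to the codewords of `P`.  No
change is needed, and no error allowed, if no queries are made. -/
noncomputable def Code.multiUse (P : Code K n) (Q : ℕ) : Code K n where
  keyGen := P.keyGen
  enc k := if Q = 0 then P.enc k else PMF.uniformOfFintype (Word n)
  dec := P.dec

theorem mean_le_mean_uniform_add_tvUniform {α : Type} [Fintype α] [Nonempty α] (p : PMF α)
    {f : α → ℝ≥0∞} (hf : ∀ a, f a ≤ 1) :
    mean p f ≤ mean (PMF.uniformOfFintype α) f + ENNReal.ofReal (tvUniform p) := by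
  simp only [mean_eq_sum, tvUniform, PMF.uniformOfFintype_apply]
  rw [ENNReal.ofReal_sum_of_nonneg fun a _ => le_max_right _ _, ← Finset.sum_add_distrib]
  refine Finset.sum_le_sum fun a _ => ?_
  calc p a * f a ≤ ((Fintype.card α : ℝ≥0∞)⁻¹ +
          ENNReal.ofReal (max ((p a).toReal - (Fintype.card α : ℝ)⁻¹) 0)) * f a := by
        gcongr
        rw [← ENNReal.ofReal_toReal (p.apply_ne_top a), ← ENNReal.ofReal_natCast,
          ← ENNReal.ofReal_inv_of_pos (by exact_mod_cast Fintype.card_pos),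
          ← ENNReal.ofReal_add (by positivity) (le_max_right _ _),
          ENNReal.toReal_ofReal ENNReal.toReal_nonneg]
        have hmax := le_max_left ((p a).toReal - (Fintype.card α : ℝ)⁻¹) 0
        exact ENNReal.ofReal_le_ofReal (by linarith)
    _ ≤ _ := by
        rw [add_mul]
        gcongr
        exact mul_le_of_le_one_right' (hf a)

theorem Code.acceptance_le_multiUse (P : Code K n) (Q : ℕ) (ρ : unitInterval) :
    P.acceptance ρ ≤ (P.multiUse Q).acceptance ρ +
      Q * mean P.keyGen fun k => ENNReal.ofReal (tvUniform (P.enc k)) := by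
  obtain rfl | hQ := Nat.eq_zero_or_pos Q
  · exact le_add_right (by simp only [acceptance, multiUse, if_true, le_refl])
  have huniform : P.acceptance ρ ≤ (P.multiUse Q).acceptance ρ +
      mean P.keyGen fun k => ENNReal.ofReal (tvUniform (P.enc k)) := by
    simp only [acceptance, multiUse, hQ.ne', if_false, apply_true_eq_mean, mean_bind P.keyGen,
      ← mean_add]
    refine mean_mono fun k _ => ?_
    rw [mean_bind, mean_bind]
    exact mean_le_mean_uniform_add_tvUniform _ fun c =>
      mean_le_of_forall_le fun b _ => ite_le_one _
  exact huniform.trans (add_le_add_right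
    (le_mul_of_one_le_left' (by exact_mod_cast hQ)) _)

theorem Code.Complete.of_acceptance_le {K' : Type} {P : Code K n} {P' : Code K' n}
    {ρ : unitInterval} {δ e δ' : ℝ} (h : P.Complete ρ δ) (he : 0 ≤ e)
    (hle : P.acceptance ρ ≤ P'.acceptance ρ + ENNReal.ofReal e) (hδ : δ + e ≤ δ') :
    P'.Complete ρ δ' := by
  have hne : P'.acceptance ρ ≠ ⊤ := PMF.apply_ne_top _ _
  have hreal := ENNReal.toReal_mono (ENNReal.add_ne_top.2 ⟨hne, ENNReal.ofReal_ne_top⟩) hle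
  rw [ENNReal.toReal_add hne ENNReal.ofReal_ne_top, ENNReal.toReal_ofReal he] at hreal
  have hδP : 1 - δ ≤ (P.acceptance ρ).toReal := h
  exact (by linarith : 1 - δ' ≤ (P'.acceptance ρ).toReal)

end MultiUse

section Tabled

variable {lam n : ℕ} {P : ROCode lam n}

theorem pseudorandom_tabled_one {q : ℕ∞} {ε : ℝ} (h : P.inROM.Pseudorandom q ε) (hq : 1 ≤ q)
    (N : ℕ) : (P.tabled N).Pseudorandom 1 ε := by
  intro m hm A
  convert h m (hm.trans hq) A using 4
  rw [← tabled_keyGen_bind_consistentOracle P N fun k => (iid (P.inROM.enc k) m).bind A]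
  congr 1
  funext k
  rw [← PMF.bind_bind]
  congr 1
  refine eq_of_forall_mean_eq fun φ => ?_
  obtain rfl | rfl : m = 0 ∨ m = 1 := by
    have : m ≤ 1 := by exact_mod_cast hm
    omega
  · simp only [mean_bind, mean_iid_zero, mean_const]
  · simp only [mean_bind, mean_iid_one, ROCode.tabled]

theorem enc_tabled_of_no_queries (hP : P.QueriesAtMost 0) (N : ℕ)
    {k : List Bool × List (Word lam × Bool)} (hk : k.1 ∈ P.keyGen.support) (F : Oracle lam) :
    (P.tabled N).enc k = P.inROM.enc (k.1, F) := by
  have heval : ∀ F' : Oracle lam, P.inROM.enc (k.1, F') = P.inROM.enc (k.1, F) := fun F' => by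
    refine eq_of_forall_mean_eq fun φ => ?_
    simp only [ROCode.inROM, mean_map]
    refine mean_congr fun T hT => ?_
    have hT0 : T.queries F = ∅ :=
      Finset.card_eq_zero.1 (Nat.le_zero.1 (T.card_queries_le ((hP k.1 hk).1 T hT) F))
    have hcongr : ∀ x ∈ T.queries F, F' x = F x := by simp [hT0]
    rw [T.eval_congr hcongr]
  change (consistentOracle k.2).bind (fun F' => P.inROM.enc (k.1, F')) = _
  simp only [heval, PMF.bind_const]

theorem pseudorandom_tabled_of_no_queries (hP : P.QueriesAtMost 0) {q : ℕ∞} {ε : ℝ}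
    (h : P.inROM.Pseudorandom q ε) (N : ℕ) : (P.tabled N).Pseudorandom q ε := by
  intro m hm A
  convert h m hm A using 4
  rw [← tabled_keyGen_bind_consistentOracle P N fun k => (iid (P.inROM.enc k) m).bind A]
  refine eq_of_forall_mean_eq fun φ => ?_
  rw [mean_bind, mean_bind]
  refine mean_congr fun k hk => ?_
  have hk1 := (mem_support_tabled_keyGen hP hk).1
  simp only [← enc_tabled_of_no_queries hP N hk1, PMF.bind_const]

theorem pseudorandom_multiUse_tabled {Q : ℕ} (hP : P.QueriesAtMost Q) {q : ℕ∞} {ε : ℝ}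
    (h : P.inROM.Pseudorandom q ε) (N : ℕ) : ((P.tabled N).multiUse Q).Pseudorandom q ε := by
  obtain rfl | hQ := Nat.eq_zero_or_pos Q
  · simpa only [Code.Pseudorandom, Code.multiUse, if_true] using
      pseudorandom_tabled_of_no_queries hP h N
  · intro m _ A
    simpa only [Code.multiUse, hQ.ne', if_false, PMF.bind_const, sub_self, abs_zero] using
      h.nonneg

theorem sound_tabled {μ : ℝ} (h : P.inROM.Sound μ) (N : ℕ) : (P.tabled N).Sound μ := by
  intro c
  have hc := h c
  rwa [← tabled_keyGen_bind_consistentOracle P N fun k => P.inROM.dec k c] at hc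

end Tabled

section Compile

variable {lam n Q ℓ : ℕ} {P : ROCode lam n} {ρ : unitInterval} {q : ℕ∞} {τ δ ε μ : ℝ}

theorem compiledError_nonneg {C : ℝ} (hC : 0 ≤ C) (ρ : ℝ) (lam n Q : ℕ) (hτ : 0 ≤ τ)
    (hδ : 0 ≤ δ) (ε : ℝ) : 0 ≤ compiledError C ρ lam n Q τ δ ε := by
  unfold compiledError
  positivity

variable (hlam : 1 ≤ lam) (hP : P.QueriesAtMost Q) (hτ0 : 0 < τ) (hτ1 : τ ≤ 1)
  (hℓ : ∀ sk ∈ P.keyGen.support, sk.length ≤ ℓ)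

include hlam hP hτ0 hτ1 hℓ

theorem length_le_of_mem_support_compile {k : List Bool}
    (hk : k ∈ (compile P Q τ).keyGen.support) :
    (k.length : ℝ) ≤ ℓ + 6 * (Q * (lam : ℝ) ^ 2 / τ) := by
  have hlen : (k.length : ℝ) ≤ (ℓ + Q * ⌈lam / τ⌉₊ * (lam + 2) : ℕ) := by
    exact_mod_cast length_le_of_mem_support_compile_keyGen hℓ hP hk
  rw [Nat.cast_add] at hlen
  linarith [mul_ceil_div_mul_le (Q := Q) hlam hτ0 hτ1]

variable (hq : q = ⊤ ∨ ∃ m : ℕ, (m : ℕ∞) ≤ q ∧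
  (ℓ : ℝ) + Q * (lam : ℝ) ^ 2 / τ ≤ m * (ε * n))

include hq

theorem mul_mean_tabled_tvUniform_le (h : P.inROM.Pseudorandom q ε) :
    (Q * mean (P.tabled ⌈lam / τ⌉₊).keyGen fun k =>
      ENNReal.ofReal (tvUniform ((P.tabled ⌈lam / τ⌉₊).enc k))) ≤
      ENNReal.ofReal (3 * ((Q : ℝ) ^ 2 * √(ε * n))) := by
  obtain rfl | hQ := Nat.eq_zero_or_pos Q
  · rw [Nat.cast_zero, zero_mul]
    exact zero_le
  calc _ ≤ (Q : ℝ≥0∞) * ENNReal.ofReal (3 * √(ε * n)) := by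
        gcongr
        exact mean_tabled_tvUniform_le_sqrt hlam hQ hP hτ0 hτ1 h hℓ hq
    _ = ENNReal.ofReal (Q * (3 * √(ε * n))) := by
        rw [ENNReal.ofReal_mul (Nat.cast_nonneg Q), ENNReal.ofReal_natCast]
    _ ≤ _ := by
        have hQsq : (Q : ℝ) ≤ (Q : ℝ) ^ 2 := by exact_mod_cast Nat.le_self_pow two_ne_zero Q
        refine ENNReal.ofReal_le_ofReal ?_
        nlinarith [Real.sqrt_nonneg (ε * n)]

theorem acceptance_inROM_le_tabled (h : P.inROM.Pseudorandom q ε) :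
    P.inROM.acceptance ρ ≤ (P.tabled ⌈lam / τ⌉₊).acceptance ρ +
      ENNReal.ofReal (compiledError 3 ρ lam n Q τ 0 ε) := by
  refine (acceptance_inROM_le hP ρ hτ0).trans ?_
  have hQsq : (Q : ℝ) ≤ (Q : ℝ) ^ 2 := by exact_mod_cast Nat.le_self_pow two_ne_zero Q
  rw [compiledError, zero_add, add_assoc, ENNReal.ofReal_add (by positivity) (by positivity),
    ENNReal.ofReal_add (by positivity) (by positivity)]
  gcongr
  exact mul_mean_tabled_tvUniform_le hlam hP hτ0 hτ1 hℓ hq h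

theorem acceptance_inROM_le_multiUse (h : P.inROM.Pseudorandom q ε) :
    P.inROM.acceptance ρ ≤ ((P.tabled ⌈lam / τ⌉₊).multiUse Q).acceptance ρ +
      ENNReal.ofReal (compiledError 6 ρ lam n Q τ 0 ε) := by
  have hsplit : compiledError 6 ρ lam n Q τ 0 ε =
      3 * ((Q : ℝ) ^ 2 * √(ε * n)) + compiledError 3 ρ lam n Q τ 0 ε := by
    unfold compiledError
    ring
  rw [hsplit, ENNReal.ofReal_add (by positivity)
    (compiledError_nonneg (by norm_num) ρ lam n Q hτ0.le le_rfl ε), ← add_assoc]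
  refine (acceptance_inROM_le_tabled hlam hP hτ0 hτ1 hℓ hq h).trans ?_
  gcongr
  refine ((P.tabled ⌈lam / τ⌉₊).acceptance_le_multiUse Q ρ).trans ?_
  gcongr
  exact mul_mean_tabled_tvUniform_le hlam hP hτ0 hτ1 hℓ hq h

theorem isPRC_compile (h : P.inROM.IsPRC ρ q δ ε μ) (hq1 : 1 ≤ q) :
    (compile P Q τ).IsPRC ρ 1 (compiledError 6 ρ lam n Q τ δ ε) ε μ := by
  have htabled : (P.tabled ⌈lam / τ⌉₊).IsPRC ρ 1 (compiledError 6 ρ lam n Q τ δ ε) ε μ :=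
    { complete := h.complete.of_acceptance_le
        (compiledError_nonneg (by norm_num) ρ lam n Q hτ0.le le_rfl ε)
        (acceptance_inROM_le_tabled hlam hP hτ0 hτ1 hℓ hq h.pseudorandom) (by
          unfold compiledError
          linarith [mul_nonneg (sq_nonneg (Q : ℝ)) (Real.sqrt_nonneg (ε * n))])
      pseudorandom := pseudorandom_tabled_one h.pseudorandom hq1 _
      sound := sound_tabled h.sound _ }
  refine htabled.map_keys (compile_keyGen P Q τ) (fun k hk => ?_) fun k hk => ?_
  · rw [compile_enc, parseKey_encodeKey_of_mem_support hP hk]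
  · rw [compile_dec, parseKey_encodeKey_of_mem_support hP hk]

theorem isPRC_multiUse_compile (h : P.inROM.IsPRC ρ q δ ε μ) :
    ((compile P Q τ).multiUse Q).IsPRC ρ q (compiledError 6 ρ lam n Q τ δ ε) ε μ := by
  have htabled : ((P.tabled ⌈lam / τ⌉₊).multiUse Q).IsPRC ρ q
      (compiledError 6 ρ lam n Q τ δ ε) ε μ :=
    { complete := h.complete.of_acceptance_le
        (compiledError_nonneg (by norm_num) ρ lam n Q hτ0.le le_rfl ε)
        (acceptance_inROM_le_multiUse hlam hP hτ0 hτ1 hℓ hq h.pseudorandom) (by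
          unfold compiledError
          linarith)
      pseudorandom := pseudorandom_multiUse_tabled hP h.pseudorandom _
      sound := sound_tabled h.sound _ }
  refine htabled.map_keys (compile_keyGen P Q τ) (fun k hk => ?_) fun k hk => ?_
  · simp only [Code.multiUse, compile_enc, parseKey_encodeKey_of_mem_support hP hk]
  · simp only [Code.multiUse, compile_dec, parseKey_encodeKey_of_mem_support hP hk]

end Compile

end PRC

theorem mainTheorem3 :
    ∃ C : ℝ, 0 < C ∧
      ∀ (n ℓ Q : ℕ → ℕ) (q : ℕ → ℕ∞) (ρ : ℕ → unitInterval) (δ ε μ τ : ℕ → ℝ)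
        (P : (lam : ℕ) → PRC.ROCode lam (n lam)),
        (∀ lam ≥ 1, ∀ sk ∈ (P lam).keyGen.support, sk.length ≤ ℓ lam) →
        (∀ lam ≥ 1, (P lam).QueriesAtMost (Q lam)) →
        (∀ lam ≥ 1, (P lam).inROM.IsPRC (ρ lam) (q lam) (δ lam) (ε lam) (μ lam)) →
        (∀ lam ≥ 1, 0 < τ lam ∧ τ lam < 1) →
        (∀ lam ≥ 1, 1 ≤ q lam ∧ (q lam = ⊤ ∨ ∃ m : ℕ, (m : ℕ∞) ≤ q lam ∧
          (ℓ lam : ℝ) + Q lam * (lam : ℝ) ^ 2 / τ lam ≤ m * (ε lam * n lam))) →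
        (∃ P' : (lam : ℕ) → PRC.StdCode (n lam), ∀ lam ≥ 1,
          (P' lam).IsPRC (ρ lam) (q lam)
            (PRC.compiledError C (ρ lam) lam (n lam) (Q lam) (τ lam) (δ lam) (ε lam))
            (ε lam) (μ lam) ∧
          (∀ sk ∈ (P' lam).keyGen.support,
            (sk.length : ℝ) ≤ ℓ lam + C * (Q lam * (lam : ℝ) ^ 2 / τ lam)) ∧
          (P' lam).keyGen = (PRC.compile (P lam) (Q lam) (τ lam)).keyGen ∧
          (P' lam).dec = (PRC.compile (P lam) (Q lam) (τ lam)).dec) ∧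
        ∀ lam ≥ 1,
          (PRC.compile (P lam) (Q lam) (τ lam)).IsPRC (ρ lam) 1
            (PRC.compiledError C (ρ lam) lam (n lam) (Q lam) (τ lam) (δ lam) (ε lam))
            (ε lam) (μ lam) ∧
          PRC.missProbability (P lam) (τ lam) ≤ (2⁻¹ : ℝ) ^ lam * Q lam / τ lam := by
  refine ⟨6, by norm_num, fun n ℓ Q q ρ δ ε μ τ P hℓ hP hPRC hτ hq => ⟨⟨fun lam =>
    (PRC.compile (P lam) (Q lam) (τ lam)).multiUse (Q lam), fun lam hlam =>
      ⟨?_, fun sk hsk => ?_, rfl, rfl⟩⟩, fun lam hlam => ⟨?_, ?_⟩⟩⟩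
  · exact PRC.isPRC_multiUse_compile hlam (hP lam hlam) (hτ lam hlam).1 (hτ lam hlam).2.le
      (hℓ lam hlam) (hq lam hlam).2 (hPRC lam hlam)
  · exact PRC.length_le_of_mem_support_compile hlam (hP lam hlam) (hτ lam hlam).1
      (hτ lam hlam).2.le (hℓ lam hlam) hsk
  · exact PRC.isPRC_compile hlam (hP lam hlam) (hτ lam hlam).1 (hτ lam hlam).2.le
      (hℓ lam hlam) (hq lam hlam).2 (hPRC lam hlam) (hq lam hlam).1
  · exact PRC.missProbability_le (hP lam hlam) (hτ lam hlam).1
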